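/- Let $\mathbb{K}$ be a field. A semi-free DGA over $\mathbb{K}$ is the free unital associative $\mathbb{K}$-algebra $\mathcal{A}$ on a set $A$ with a grading $\mathrm{gr}\colon A\to\mathbb{Z}$, with a differential $\partial$ of degree $-1$, $\partial^2=0$, satisfying $\partial(xy)=\partial(x)y+(-1)^{\mathrm{gr}(x)}x\,\partial(y)$. A stabilisation of $\mathcal{A}$ is a semi-free DGA whose generators are those of $\mathcal{A}$ (with the same degrees and differentials) and two more, $b$ and $c$, with $\partial b=c$. Two semi-free DGAs are stable isomorphic if, after finitely many stabilisations of each, there is a degree preserving algebra isomorphism between them that commutes with the differentials. An augmentation of $\mathcal{A}$ is a unital $\mathbb{K}$-algebra map $\varepsilon\colon\mathcal{A}\to\mathbb{K}$ with $\varepsilon\circ\partial=0$ and $\varepsilon(a)=0$ for all generators $a$ with $\mathrm{gr}(a)\neq0$. The augmentation category $\mathit{Aug}(\mathcal{A})$ is the (non-unital) $\mathcal{A}_\infty$-category whose objects are the augmentations, whose morphism spaces $C_{\varepsilon_1,\varepsilon_0}$ (from $\varepsilon_0$ to $\varepsilon_1$) are all equal to the graded dual $C^*(A)$ of the vector space with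 basis $A$, the dual of a generator $a$ having degree $|a|=\mathrm{gr}(a)+1$, and whose operations $\mu^d\colon C_{\varepsilon_d,\varepsilon_{d-1}}\otimes\cdots\otimes C_{\varepsilon_1,\varepsilon_0}\to C_{\varepsilon_d,\varepsilon_0}$, of degree $2-d$, $d\geq1$, are $$\mu^d(f_d,\ldots,f_1)(a)=(-1)^{|f_1|+\cdots+|f_d|-d}\sum x\;\varepsilon_d(w_d)f_d(b_d)\,\varepsilon_{d-1}(w_{d-1})\cdots f_1(b_1)\,\varepsilon_0(w_0)$$ for homogeneous $f_i$ and $a\in A$. The sum is over all words in $\partial a$, with $x$ the coefficient of the word, and over all ways of writing the word as $w_db_dw_{d-1}\cdots b_1w_0$ with $b_i\in A$. They satisfy the relations $\sum_{i,j}(-1)^{|a_1|+\cdots+|a_j|-j}\mu(a_d,\ldots,\mu^i(a_{j+i},\ldots,a_{j+1}),a_j,\ldots,a_1)=0$. Two $\mathcal{A}_\infty$-categories $\mathcal{B}$, $\mathcal{C}$ are pseudo-equivalent if there is an $\mathcal{A}_\infty$-functor $\mathcal{F}\colon\mathcal{B}\to\mathcal{C}$ such that (i) $\mathcal{F}$ is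 cohomologically full and faithful, i.e. $F^1\colon C^{\mathcal{B}}_{\varepsilon_1,\varepsilon_0}\to C^{\mathcal{C}}_{F(\varepsilon_1),F(\varepsilon_0)}$ induces an isomorphism on cohomology for all objects $\varepsilon_0,\varepsilon_1$ of $\mathcal{B}$; and (ii) every object $\varepsilon$ of $\mathcal{C}$ is pseudo-isomorphic to an object of the form $F(\varepsilon')$, i.e. there is a (degree $0$) morphism $T$ of right $\mathcal{A}_\infty$-modules from the right Yoneda module $\mathcal{Y}_r^{\varepsilon}\colon\varepsilon_0\mapsto C_{\varepsilon,\varepsilon_0}$ to $\mathcal{Y}_r^{F(\varepsilon')}$ whose first term $T^1\colon C_{\varepsilon,\varepsilon_0}\to C_{F(\varepsilon'),\varepsilon_0}$ induces an isomorphism on cohomology for every object $\varepsilon_0$ of $\mathcal{C}$. Theorem. Let $\mathcal{A}$ and $\mathcal{A}'$ be two stable isomorphic semi-free DGAs over $\mathbb{K}$. Then their augmentation categories $\mathit{Aug}(\mathcal{A})$ and $\mathit{Aug}(\mathcal{A}')$ are pseudo-equivalent. -/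

import Mathlib

universe u v w u' v'

namespace AInf

/-! ### Signs and composable chains of morphisms -/

/-- The sign `(-1) ^ n`, as an element of the field `K`. -/
def sgn (K : Type w) [Field K] (n : ℤ) : K := ((n.negOnePow : ℤ) : K)

/-- `Hom Y X k` stands for the degree `k` part of the space `C_{Y,X}` of morphisms from `X` to `Y`.
An element of `Chain Hom Y X` is a composable tuple `(a_d, …, a_1)` of homogeneous elements
`a_i ∈ C_{X_i, X_{i-1}}` with `X_d = Y` and `X_0 = X`; the leftmost entry `a_d` is the head, and
`nil` is the empty tuple (`d = 0`). -/
inductive Chain {Ob : Type u} (Hom : Ob → Ob → ℤ → Type v) : Ob → Ob → Type (max u v)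
  | nil (X : Ob) : Chain Hom X X
  | cons {Z Y X : Ob} {k : ℤ} (a : Hom Z Y k) (c : Chain Hom Y X) : Chain Hom Z X

namespace Chain

variable {Ob : Type u} {Hom : Ob → Ob → ℤ → Type v}

/-- The total reduced degree `∑ (|a_i| - 1)` of a chain, i.e. `|a_1| + ⋯ + |a_d| - d`. -/
def red : {Z X : Ob} → Chain Hom Z X → ℤ
  | _, _, nil _ => 0
  | _, _, cons (k := k) _ c => (k - 1) + red c

/-- Concatenation of chains. -/
def append : {Z Y X : Ob} → Chain Hom Z Y → Chain Hom Y X → Chain Hom Z X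
  | _, _, _, nil _, c => c
  | _, _, _, cons a b, c => cons a (append b c)

/-- The chain with the single entry `a`. -/
def single {Y X : Ob} {k : ℤ} (a : Hom Y X k) : Chain Hom Y X := cons a (nil X)

/-- The sum of `φ u v` over all `d + 1` ways of cutting a chain `c` of length `d` into two
consecutive (possibly empty) pieces `u`, `v`. -/
def sumSplit {M : Type w} [AddCommMonoid M] : {Z X : Ob} → Chain Hom Z X →
    (∀ Y : Ob, Chain Hom Z Y → Chain Hom Y X → M) → M
  | _, _, nil X, φ => φ X (nil X) (nil X)
  | _, _, cons a c, φ => φ _ (nil _) (cons a c) + sumSplit c fun Y u v => φ Y (cons a u) v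

/-- The sum of `φ u m v` over all ways of cutting a chain into three consecutive (possibly empty)
pieces `u`, `m`, `v`. -/
def sumSplit₃ {M : Type w} [AddCommMonoid M] {Z X : Ob} (c : Chain Hom Z X)
    (φ : ∀ Y W : Ob, Chain Hom Z Y → Chain Hom Y W → Chain Hom W X → M) : M :=
  c.sumSplit fun Y u t => t.sumSplit fun W m v => φ Y W u m v

/-- A function on chains with fixed end points is multilinear if it is `K`-linear in each entry. -/
structure IsMultilinear (K : Type w) [Field K] [∀ Y X k, AddCommGroup (Hom Y X k)]
    [∀ Y X k, Module K (Hom Y X k)] {Z X : Ob} {M : Type v'} [AddCommGroup M] [Module K M]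
    (φ : Chain Hom Z X → M) : Prop where
  map_add : ∀ {Y W : Ob} {k : ℤ} (u : Chain Hom Z Y) (a b : Hom Y W k) (v : Chain Hom W X),
    φ (u.append (cons (a + b) v)) = φ (u.append (cons a v)) + φ (u.append (cons b v))
  map_smul : ∀ {Y W : Ob} {k : ℤ} (u : Chain Hom Z Y) (r : K) (a : Hom Y W k)
    (v : Chain Hom W X), φ (u.append (cons (r • a) v)) = r • φ (u.append (cons a v))

end Chain

open Chain

/-! ### A-infinity categories -/

/-- A (not necessarily unital) `A_∞`-category over the field `K`, with cohomological grading.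

`mu c q` is the degree `q` component of `μ^d(a_d, …, a_1)` for `c = (a_d, …, a_1)`. As
`μ^d` has degree `2 - d`, it vanishes unless `q = |a_1| + ⋯ + |a_d| + 2 - d`. There is no `μ^0`
(by convention it is `0`, so the empty middle pieces contribute nothing to the relations). The
last field is
`∑_{i,j} (-1)^{|a_1| + ⋯ + |a_j| - j} μ(a_d, …, μ(a_{j+i}, …, a_{j+1}), a_j, …, a_1) = 0`. -/
structure AInfCat (K : Type w) [Field K] where
  Ob : Type u
  Hom : Ob → Ob → ℤ → Type v
  [addCommGroup : ∀ Y X k, AddCommGroup (Hom Y X k)]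
  [module : ∀ Y X k, Module K (Hom Y X k)]
  mu : ∀ {Y X : Ob}, Chain Hom Y X → ∀ q : ℤ, Hom Y X q
  mu_nil : ∀ (X : Ob) (q : ℤ), mu (nil X) q = 0
  mu_degree : ∀ {Y X : Ob} (c : Chain Hom Y X) (q : ℤ), q ≠ c.red + 2 → mu c q = 0
  mu_multilinear : ∀ (Y X : Ob) (q : ℤ),
    IsMultilinear K fun c : Chain Hom Y X => mu c q
  mu_relation : ∀ {Y X : Ob} (c : Chain Hom Y X) (q : ℤ),
    (c.sumSplit₃ fun _ _ u m v =>
      sgn K v.red • mu (u.append (cons (mu m (m.red + 2)) v)) q) = 0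

attribute [instance] AInfCat.addCommGroup AInfCat.module

namespace AInfCat

variable {K : Type w} [Field K] (A : AInfCat.{u, v} K)

/-- `μ^1 : C_{Y,X}^k → C_{Y,X}^l`, which is zero unless `l = k + 1`. -/
def d (Y X : A.Ob) (k l : ℤ) : A.Hom Y X k →ₗ[K] A.Hom Y X l where
  toFun a := A.mu (single a) l
  map_add' a b := (A.mu_multilinear Y X l).map_add (nil Y) a b (nil X)
  map_smul' r a := (A.mu_multilinear Y X l).map_smul (nil Y) r a (nil X)

/-- The cocycles in degree `k` of the complex `(C_{Y,X}, μ^1)`. -/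
abbrev cocycles (Y X : A.Ob) (k : ℤ) : Submodule K (A.Hom Y X k) :=
  LinearMap.ker (A.d Y X k (k + 1))

/-- The cohomology `H^k(C_{Y,X}, μ^1)`. -/
abbrev H (Y X : A.Ob) (k : ℤ) : Type v :=
  A.cocycles Y X k ⧸ (LinearMap.range (A.d Y X (k - 1) k)).comap (A.cocycles Y X k).subtype

end AInfCat

section Functors

variable {K : Type w} [Field K]

/-- A graded linear map `φ` of degree `0` between two morphism complexes (commuting, up to sign,
with the differentials) induces an isomorphism on cohomology. -/
def InducesIso (A : AInfCat.{u, v} K) (B : AInfCat.{u', v'} K) {Y X : A.Ob} {Y' X' : B.Ob}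
    (φ : ∀ k : ℤ, A.Hom Y X k → B.Hom Y' X' k) : Prop :=
  ∀ k : ℤ, ∃ e : A.H Y X k ≃ₗ[K] B.H Y' X' k,
    ∀ x : A.cocycles Y X k, ∃ hx : φ k x ∈ B.cocycles Y' X' k,
      e (Submodule.Quotient.mk x) = Submodule.Quotient.mk ⟨φ k x, hx⟩

section Blocks

variable {Ob : Type u} {Hom : Ob → Ob → ℤ → Type v} {Ob' : Type u'} {Hom' : Ob' → Ob' → ℤ → Type v'}
  (F : Ob → Ob') (Fm : ∀ {Y X : Ob}, Chain Hom Y X → ∀ q : ℤ, Hom' (F Y) (F X) q)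
  {M : Type w} [AddCommMonoid M]

/-- Auxiliary recursion for `sumBlocks`: `m` is the block that is being read, `c` what remains. -/
def sumBlocksAux : {Z Y X : Ob} → Chain Hom Z Y → Chain Hom Y X →
    (Chain Hom' (F Z) (F X) → M) → M
  | _, _, _, m, nil _, φ => φ (single (Fm m (m.red + 1)))
  | _, _, _, m, cons a c, φ =>
      sumBlocksAux (m.append (single a)) c φ +
        sumBlocksAux (single a) c fun t => φ (cons (Fm m (m.red + 1)) t)

/-- The sum of `φ (F^{s_r}(a_d, …, a_{d-s_r+1}), …, F^{s_1}(a_{s_1}, …, a_1))` over all ways of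
cutting `(a_d, …, a_1)` into nonempty consecutive blocks of lengths `s_r, …, s_1`, with `r ≥ 1`
arbitrary; here `F^s` has degree `1 - s`. -/
def sumBlocks : {Z X : Ob} → Chain Hom Z X → (Chain Hom' (F Z) (F X) → M) → M
  | _, _, nil X, φ => φ (nil (F X))
  | _, _, cons a c, φ => sumBlocksAux F Fm (single a) c φ

end Blocks

/-- An `A_∞`-functor. `map c q` is the degree `q` component of `F^d(a_d, …, a_1)`; as `F^d` has
degree `1 - d`, it vanishes unless `q = |a_1| + ⋯ + |a_d| + 1 - d`. There is no `F^0`. -/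
structure AInfFunctor (A : AInfCat.{u, v} K) (B : AInfCat.{u', v'} K) where
  obj : A.Ob → B.Ob
  map : ∀ {Y X : A.Ob}, Chain A.Hom Y X → ∀ q : ℤ, B.Hom (obj Y) (obj X) q
  map_nil : ∀ (X : A.Ob) (q : ℤ), map (nil X) q = 0
  map_degree : ∀ {Y X : A.Ob} (c : Chain A.Hom Y X) (q : ℤ), q ≠ c.red + 1 → map c q = 0
  map_multilinear : ∀ (Y X : A.Ob) (q : ℤ),
    IsMultilinear K fun c : Chain A.Hom Y X => map c q
  map_relation : ∀ {Y X : A.Ob} (c : Chain A.Hom Y X) (q : ℤ),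
    (sumBlocks obj map c fun t => B.mu t q) =
      c.sumSplit₃ fun _ _ u m v =>
        sgn K v.red • map (u.append (cons (A.mu m (m.red + 2)) v)) q

/-- `F` is cohomologically full and faithful: `F^1` induces isomorphisms on the cohomology of all
morphism complexes. -/
def AInfFunctor.CohomFullyFaithful {A : AInfCat.{u, v} K} {B : AInfCat.{u', v'} K}
    (F : AInfFunctor A B) : Prop :=
  ∀ Y X : A.Ob, InducesIso A B (Y := Y) (X := X) (Y' := F.obj Y) (X' := F.obj X)
    fun k a => F.map (single a) k

/-- A (degree `0`) morphism of right `A_∞`-modules between the right Yoneda modules of `E` and `E'`: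
a family of maps
`T^d : C_{E,X_{d-1}} ⊗ C_{X_{d-1},X_{d-2}} ⊗ ⋯ ⊗ C_{X_1,X_0} → C_{E',X_0}` of degree `1 - d`, `d ≥ 1`,
such that
`∑_j (-1)^† μ(T(a_d, …, a_{j+1}), a_j, …, a_1)
  + ∑_{i,j} (-1)^† T(a_d, …, μ(a_{j+i}, …, a_{j+1}), a_j, …, a_1) = 0`,
where `† = |a_{j+1}| + ⋯ + |a_d| - d + j + 1`. -/
structure YonedaMorphism (A : AInfCat.{u, v} K) (E E' : A.Ob) where
  map : ∀ {X : A.Ob}, Chain A.Hom E X → ∀ q : ℤ, A.Hom E' X q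
  map_nil : ∀ q : ℤ, map (nil E) q = 0
  map_degree : ∀ {X : A.Ob} (c : Chain A.Hom E X) (q : ℤ), q ≠ c.red + 1 → map c q = 0
  map_multilinear : ∀ (X : A.Ob) (q : ℤ),
    IsMultilinear K fun c : Chain A.Hom E X => map c q
  map_relation : ∀ {X : A.Ob} (c : Chain A.Hom E X) (q : ℤ),
    (c.sumSplit fun _ u v =>
        sgn K (u.red + 1) • A.mu (cons (map u (u.red + 1)) v) q) +
      (c.sumSplit₃ fun _ _ u m v =>
        sgn K (u.red + m.red + 1) • map (u.append (cons (A.mu m (m.red + 2)) v)) q) = 0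

/-- `E` is pseudo-isomorphic to `E'`: there is a quasi-isomorphism from the right Yoneda module of
`E` to that of `E'`. -/
def PseudoIsomorphic (A : AInfCat.{u, v} K) (E E' : A.Ob) : Prop :=
  ∃ T : YonedaMorphism A E E', ∀ X : A.Ob,
    InducesIso A A (Y := E) (X := X) (Y' := E') (X' := X) fun k a => T.map (single a) k

/-- `A` and `B` are pseudo-equivalent: there is a cohomologically full and faithful functor
`F : A → B` such that each object of `B` is pseudo-isomorphic to some `F(X)`. -/
def PseudoEquivalent (A : AInfCat.{u, v} K) (B : AInfCat.{u', v'} K) : Prop :=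
  ∃ F : AInfFunctor A B, F.CohomFullyFaithful ∧
    ∀ E : B.Ob, ∃ X : A.Ob, PseudoIsomorphic B E (F.obj X)

end Functors

/-! ### Semi-free differential graded algebras -/

/-- The free unital associative `K`-algebra on the set `S` (the tensor algebra of the vector space
with basis `S`), with its basis of words. -/
abbrev WordAlg (K : Type w) [Field K] (S : Type u) := MonoidAlgebra K (FreeMonoid S)

/-- The generator `a` as an element of the free algebra. -/
noncomputable def gen (K : Type w) [Field K] {S : Type u} (a : S) : WordAlg K S :=
  MonoidAlgebra.single (FreeMonoid.of a) 1

/-- The degree of a word. -/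
def wordDeg {S : Type u} (gr : S → ℤ) (l : FreeMonoid S) : ℤ := (l.toList.map gr).sum

/-- `x` is homogeneous of degree `n`: all words that occur in `x` have degree `n`. -/
def IsHomog {K : Type w} [Field K] {S : Type u} (gr : S → ℤ) (n : ℤ) (x : WordAlg K S) : Prop :=
  ∀ l : FreeMonoid S, x.coeff l ≠ 0 → wordDeg gr l = n

/-- A semi-free DGA over `K`: the free algebra on a graded set of generators, with a differential
of degree `-1` that satisfies the graded Leibniz rule. -/
structure SemiFreeDGA (K : Type w) [Field K] where
  Gen : Type u
  gr : Gen → ℤ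
  diff : WordAlg K Gen →ₗ[K] WordAlg K Gen
  diff_homog : ∀ (n : ℤ) (x : WordAlg K Gen), IsHomog gr n x → IsHomog gr (n - 1) (diff x)
  leibniz : ∀ (n : ℤ) (x y : WordAlg K Gen), IsHomog gr n x →
    diff (x * y) = diff x * y + sgn K n • (x * diff y)
  diff_diff : ∀ x : WordAlg K Gen, diff (diff x) = 0

/-- Two semi-free DGAs are isomorphic: there is a degree preserving algebra isomorphism that
commutes with the differentials. -/
def IsomorphicDGA {K : Type w} [Field K] (D : SemiFreeDGA.{u} K) (D' : SemiFreeDGA.{u'} K) : Prop :=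
  ∃ f : WordAlg K D.Gen ≃ₐ[K] WordAlg K D'.Gen,
    (∀ (n : ℤ) (x : WordAlg K D.Gen), IsHomog D.gr n x → IsHomog D'.gr n (f x)) ∧
    ∀ x : WordAlg K D.Gen, f (D.diff x) = D'.diff (f x)

/-- `D'` is a stabilisation of `D`: it has the generators of `D`, with their degrees and
differentials, and two more generators `b` and `c` with `∂b = c` (so `∂c = 0`). -/
def IsStabilisation {K : Type w} [Field K] (D D' : SemiFreeDGA.{u} K) : Prop :=
  ∃ (e : D.Gen ⊕ Bool ≃ D'.Gen),
    (∀ a : D.Gen, D'.gr (e (Sum.inl a)) = D.gr a) ∧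
    D'.gr (e (Sum.inr false)) = D'.gr (e (Sum.inr true)) - 1 ∧
    (∀ a : D.Gen, D'.diff (gen K (e (Sum.inl a))) =
      MonoidAlgebra.mapDomainAlgHom K K (FreeMonoid.map fun s : D.Gen => e (Sum.inl s))
        (D.diff (gen K a))) ∧
    D'.diff (gen K (e (Sum.inr true))) = gen K (e (Sum.inr false))

/-- Two semi-free DGAs are stable isomorphic if they become isomorphic after finitely many
stabilisations of each. -/
def StableIsomorphic {K : Type w} [Field K] (D : SemiFreeDGA.{u} K) (D' : SemiFreeDGA.{u'} K) :
    Prop :=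
  ∃ (D₁ : SemiFreeDGA.{u} K) (D₁' : SemiFreeDGA.{u'} K),
    Relation.ReflTransGen IsStabilisation D D₁ ∧
    Relation.ReflTransGen IsStabilisation D' D₁' ∧ IsomorphicDGA D₁ D₁'

/-- An augmentation of `D`: a DGA map to `(K, 0)`, with `K` in degree `0`. -/
structure Augmentation {K : Type w} [Field K] (D : SemiFreeDGA.{u} K) where
  hom : WordAlg K D.Gen →ₐ[K] K
  hom_degree : ∀ a : D.Gen, D.gr a ≠ 0 → hom (gen K a) = 0
  hom_diff : ∀ x : WordAlg K D.Gen, hom (D.diff x) = 0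

/-! ### The augmentation category -/

section Aug

variable {K : Type w} [Field K] (D : SemiFreeDGA.{u} K)

/-- The degree `k` part of the graded dual `C^*(A)` of the vector space spanned by the generators,
where the dual of a generator `a` has degree `|a| = gr(a) + 1`. It does not depend on the
augmentations `Y`, `X`. -/
abbrev AugHom (_Y _X : Augmentation D) (k : ℤ) : Type (max u w) := {a : D.Gen // D.gr a + 1 = k} → K

variable {D}

open Classical in
/-- The value of a homogeneous form on a generator. -/
noncomputable def AugHom.val {Y X : Augmentation D} {k : ℤ} (f : AugHom D Y X k) (a : D.Gen) : K :=
  if h : D.gr a + 1 = k then f ⟨a, h⟩ else 0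

/-- For `c = (f_d, …, f_1)` with `f_i ∈ C_{ε_i, ε_{i-1}}`, the value of `c` on a word is the sum, over
all ways of writing the word as `w_d b_d w_{d-1} b_{d-1} ⋯ w_1 b_1 w_0` with generators `b_i`, of
`ε_d(w_d) f_d(b_d) ε_{d-1}(w_{d-1}) ⋯ f_1(b_1) ε_0(w_0)`. It is computed by reading the word from the
left: the first letter is either part of `w_d` or equal to `b_d`. -/
noncomputable def evalWord : {Y X : Augmentation D} → Chain (AugHom D) Y X → List D.Gen → K
  | _, _, nil _, [] => 1
  | _, _, cons _ _, [] => 0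
  | Y, _, nil _, a :: l => Y.hom (gen K a) * evalWord (nil Y) l
  | Y, _, cons f c, a :: l =>
      Y.hom (gen K a) * evalWord (cons f c) l + AugHom.val f a * evalWord c l

/-- The linear extension of `evalWord c` to the free algebra. -/
noncomputable def eval {Y X : Augmentation D} (c : Chain (AugHom D) Y X) :
    WordAlg K D.Gen →ₗ[K] K :=
  (Finsupp.linearCombination K fun l : FreeMonoid D.Gen => evalWord c l.toList) ∘ₗ
    (MonoidAlgebra.coeffLinearEquiv K).toLinearMap

/-- The operation `μ^d(f_d, …, f_1)(a) = (-1)^{|f_1| + ⋯ + |f_d| - d} ∑ x ε_d(w_d) f_d(b_d) ⋯ f_1(b_1)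
ε_0(w_0)`, the sum being over all words `w_d b_d w_{d-1} ⋯ b_1 w_0` in `∂a`, with coefficient `x`. -/
noncomputable def augMu {Y X : Augmentation D} (c : Chain (AugHom D) Y X) (q : ℤ) :
    AugHom D Y X q :=
  fun a => sgn K c.red * eval c (D.diff (gen K a.1))

end Aug

/-! #### The `A_∞`-relations of the augmentation category -/

namespace Chain

variable {Ob : Type u} {Hom : Ob → Ob → ℤ → Type v}

theorem sumSplit_congr {M : Type w} [AddCommMonoid M] {Z X : Ob} (c : Chain Hom Z X)
    (φ ψ : ∀ Y : Ob, Chain Hom Z Y → Chain Hom Y X → M)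
    (h : ∀ Y u v, u.red + v.red = c.red → φ Y u v = ψ Y u v) : c.sumSplit φ = c.sumSplit ψ := by
  induction c with
  | nil X => exact h _ _ _ (by simp [red])
  | cons a c ih =>
    simp only [sumSplit]
    rw [h _ _ _ (by simp [red])]
    congr 1
    exact ih _ _ fun Y u v huv => h _ _ _ (by simp only [red]; omega)

theorem sumSplit_add {M : Type w} [AddCommMonoid M] {Z X : Ob} (c : Chain Hom Z X)
    (φ ψ : ∀ Y : Ob, Chain Hom Z Y → Chain Hom Y X → M) :
    (c.sumSplit fun Y u v => φ Y u v + ψ Y u v) = c.sumSplit φ + c.sumSplit ψ := by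
  induction c with
  | nil X => rfl
  | cons a c ih => simp only [sumSplit, ih]; abel

theorem map_sumSplit {M : Type w} {N : Type v'} [AddCommMonoid M] [AddCommMonoid N]
    {Z X : Ob} (g : M →+ N) (c : Chain Hom Z X)
    (φ : ∀ Y : Ob, Chain Hom Z Y → Chain Hom Y X → M) :
    g (c.sumSplit φ) = c.sumSplit fun Y u v => g (φ Y u v) := by
  induction c with
  | nil X => rfl
  | cons a c ih => simp only [sumSplit, map_add, ih]

theorem mul_sumSplit {R : Type w} [CommRing R] {Z X : Ob} (r : R) (c : Chain Hom Z X)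
    (φ : ∀ Y : Ob, Chain Hom Z Y → Chain Hom Y X → R) :
    r * c.sumSplit φ = c.sumSplit fun Y u v => r * φ Y u v :=
  map_sumSplit (AddMonoidHom.mulLeft r) c φ

theorem red_append {Z Y X : Ob} (u : Chain Hom Z Y) (v : Chain Hom Y X) :
    (u.append v).red = u.red + v.red := by
  induction u with
  | nil X => simp [append, red]
  | cons a c ih => simp only [append, red, ih]; ring

end Chain

theorem sgn_add (K : Type w) [Field K] (m n : ℤ) : sgn K (m + n) = sgn K m * sgn K n := by
  simp [sgn, Int.negOnePow_add]

theorem sgn_mul_self (K : Type w) [Field K] (n : ℤ) : sgn K n * sgn K n = 1 := by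
  rw [← sgn_add, ← two_mul]
  simp [sgn, Int.negOnePow_two_mul]

theorem sgn_zero (K : Type w) [Field K] : sgn K 0 = 1 := by simp [sgn]

/-- The word `l` as an element of the free algebra. -/
noncomputable def word (K : Type w) [Field K] {S : Type u} (l : List S) : WordAlg K S :=
  MonoidAlgebra.single (FreeMonoid.ofList l) 1

theorem word_cons {K : Type w} [Field K] {S : Type u} (a : S) (l : List S) : word K (a :: l) = gen K a * word K l := by
  simp only [word, gen, FreeMonoid.ofList_cons, MonoidAlgebra.single_mul_single, mul_one]

theorem word_append {K : Type w} [Field K] {S : Type u} (l l' : List S) : word K (l ++ l') = word K l * word K l' := by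
  simp only [word, FreeMonoid.ofList_append, MonoidAlgebra.single_mul_single, mul_one]

theorem isHomog_gen {K : Type w} [Field K] {S : Type u} (gr : S → ℤ) (a : S) : IsHomog gr (gr a) (gen K a) := by
  classical
  intro l hl
  have : l = FreeMonoid.of a := by
    by_contra h
    apply hl
    simp only [gen, MonoidAlgebra.coeff_single]
    exact Finsupp.single_eq_of_ne h
  subst this
  simp [wordDeg]

theorem linearMap_ext_word {K : Type w} [Field K] {S : Type u} {M : Type v} [AddCommGroup M] [Module K M]
    {f g : WordAlg K S →ₗ[K] M} (h : ∀ l, f (word K l) = g (word K l)) (x : WordAlg K S) :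
    f x = g x := by
  induction x using MonoidAlgebra.induction_linear with
  | zero => simp
  | add x y hx hy => simp [hx, hy]
  | single m r =>
    have : (MonoidAlgebra.single m r : WordAlg K S) = r • word K m.toList := by
      simp [word]
    rw [this, map_smul, map_smul, h]

section Aug

variable {K : Type w} [Field K] {D : SemiFreeDGA.{u} K}

theorem diff_one : D.diff 1 = 0 := by
  have h : IsHomog D.gr 0 (1 : WordAlg K D.Gen) := by
    classical
    intro l hl
    have : l = 1 := by
      by_contra h
      apply hl
      rw [MonoidAlgebra.one_def, MonoidAlgebra.coeff_single]
      exact Finsupp.single_eq_of_ne h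
    subst this
    simp [wordDeg]
  have := D.leibniz 0 1 1 h
  simpa [sgn_zero] using this

theorem eval_word {Y X : Augmentation D} (c : Chain (AugHom D) Y X) (l : List D.Gen) :
    eval c (word K l) = evalWord c l := by
  simp [eval, word, MonoidAlgebra.coeffLinearEquiv]

theorem evalWord_nil (X : Augmentation D) (l : List D.Gen) :
    evalWord (nil X) l = X.hom (word K l) := by
  induction l with
  | nil => exact (map_one X.hom).symm
  | cons a l ih => rw [evalWord, ih, word_cons, map_mul]

theorem eval_nil (X : Augmentation D) (x : WordAlg K D.Gen) : eval (nil X) x = X.hom x :=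
  linearMap_ext_word (f := eval (nil X)) (g := X.hom.toLinearMap)
    (fun l => by rw [eval_word, evalWord_nil]; rfl) x

theorem evalWord_degree {Y X : Augmentation D} (c : Chain (AugHom D) Y X) (l : List D.Gen)
    (h : evalWord c l ≠ 0) : (l.map D.gr).sum = c.red := by
  induction l generalizing Y c with
  | nil => cases c with
    | nil => rfl
    | cons f c => exact absurd rfl h
  | cons a l ih =>
    have key : ∀ {Y X : Augmentation D} (c : Chain (AugHom D) Y X),
        Y.hom (gen K a) * evalWord c l ≠ 0 → D.gr a = 0 := by
      intro Y X c h
      by_contra h0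
      exact h (by rw [Y.hom_degree a h0, zero_mul])
    cases c with
    | nil =>
      rw [evalWord] at h
      rw [List.map_cons, List.sum_cons, key _ h, ih _ (right_ne_zero_of_mul h), zero_add]
    | @cons _ _ _ k f c =>
      rw [evalWord] at h
      by_cases h1 : Y.hom (gen K a) * evalWord (cons f c) l = 0
      · rw [h1, zero_add] at h
        have h2 : D.gr a + 1 = k := by
          by_contra h2
          exact left_ne_zero_of_mul h (by rw [AugHom.val, dif_neg h2])
        rw [List.map_cons, List.sum_cons, ih _ (right_ne_zero_of_mul h), red]
        omega
      · rw [List.map_cons, List.sum_cons, key _ h1, ih _ (right_ne_zero_of_mul h1), zero_add]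

theorem eval_degree {Y X : Augmentation D} (c : Chain (AugHom D) Y X) (n : ℤ)
    (x : WordAlg K D.Gen) (hx : IsHomog D.gr n x) (hn : n ≠ c.red) : eval c x = 0 := by
  simp only [eval, LinearMap.comp_apply, Finsupp.linearCombination_apply]
  refine Finset.sum_eq_zero fun l hl => ?_
  have h1 := hx l (by simpa using hl)
  by_contra h2
  exact hn (h1.symm.trans (evalWord_degree c _ (right_ne_zero_of_smul h2)))

theorem evalWord_append_list {Y X : Augmentation D} (c : Chain (AugHom D) Y X)
    (l l' : List D.Gen) :
    evalWord c (l ++ l') = c.sumSplit fun _ u v => evalWord u l * evalWord v l' := by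
  induction l generalizing Y c with
  | nil =>
    cases c with
    | nil => simp [sumSplit, evalWord]
    | cons f c =>
      simp only [sumSplit, evalWord, one_mul, zero_mul, List.nil_append]
      have : (c.sumSplit fun _ _ _ => (0 : K)) = 0 := by
        have := mul_sumSplit (0 : K) c fun _ _ _ => 0
        simpa using this.symm
      rw [this, add_zero]
  | cons a l ih =>
    cases c with
    | nil => simp only [List.cons_append, sumSplit, evalWord, ih]; ring
    | cons f c =>
      simp only [List.cons_append, sumSplit, evalWord, ih, add_mul, sumSplit_add, mul_add,
        mul_sumSplit, mul_assoc]
      ring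

theorem eval_mul {Y X : Augmentation D} (c : Chain (AugHom D) Y X) (x y : WordAlg K D.Gen) :
    eval c (x * y) = c.sumSplit fun _ u v => eval u x * eval v y := by
  induction x using MonoidAlgebra.induction_linear with
  | zero =>
    have := mul_sumSplit (0 : K) c fun _ _ _ => 0
    simpa using this
  | add x x' hx hx' => simp only [add_mul, map_add, hx, hx', sumSplit_add]
  | single m r =>
    induction y using MonoidAlgebra.induction_linear with
    | zero =>
      have := mul_sumSplit (0 : K) c fun _ _ _ => 0
      simpa using this
    | add x x' hx hx' => simp only [mul_add, map_add, hx, hx', sumSplit_add]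
    | single m' r' =>
      have h1 : (MonoidAlgebra.single m r : WordAlg K D.Gen) = r • word K m.toList := by
        simp [word]
      have h2 : (MonoidAlgebra.single m' r' : WordAlg K D.Gen) = r' • word K m'.toList := by
        simp [word]
      simp only [h1, h2, smul_mul_smul_comm, map_smul, ← word_append, eval_word,
        evalWord_append_list, smul_eq_mul, mul_sumSplit]
      exact sumSplit_congr _ _ _ fun _ _ _ _ => by ring

/-- The form `a ↦ c(∂a)`. -/
noncomputable def beta {Y X : Augmentation D} (c : Chain (AugHom D) Y X) :
    AugHom D Y X (c.red + 2) :=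
  fun a => eval c (D.diff (gen K a.1))

theorem beta_val {Y X : Augmentation D} (c : Chain (AugHom D) Y X) (a : D.Gen) :
    AugHom.val (beta c) a = eval c (D.diff (gen K a)) := by
  rw [AugHom.val]
  split_ifs with h
  · rfl
  · exact (eval_degree c (D.gr a - 1) _ (D.diff_homog _ _ (isHomog_gen D.gr a)) (by omega)).symm

theorem evalWord_diff {Y X : Augmentation D} (c : Chain (AugHom D) Y X) (l : List D.Gen) :
    eval c (D.diff (word K l)) = c.sumSplit₃ fun _ _ u m v =>
      sgn K u.red * evalWord (u.append (cons (beta m) v)) l := by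
  have zero : ∀ {Z X : Augmentation D} (c : Chain (AugHom D) Z X),
      (c.sumSplit fun _ _ _ => (0 : K)) = 0 := fun c => by
    have := mul_sumSplit (0 : K) c fun _ _ _ => 0
    simpa using this.symm
  induction l generalizing Y c with
  | nil =>
    have h1 : ∀ {Z W : Augmentation D} {k : ℤ} {T : Augmentation D} (u : Chain (AugHom D) Z W)
        (f : AugHom D W T k) (v : Chain (AugHom D) T X),
        evalWord (u.append (cons f v)) [] = 0 := by
      intro Z W k T u f v
      cases u <;> rfl
    have : word K ([] : List D.Gen) = 1 := rfl
    simp only [this, diff_one, map_zero, sumSplit₃, h1, mul_zero, zero]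
  | cons a l ih =>
    rw [word_cons, D.leibniz _ _ _ (isHomog_gen D.gr a), map_add, map_smul, eval_mul]
    have h2 : sgn K (D.gr a) • eval c (gen K a * D.diff (word K l)) =
        Y.hom (gen K a) * eval c (D.diff (word K l)) +
        (match c with
          | nil _ => 0
          | @cons _ _ _ _ _ k f c => sgn K (k - 1) *
              (AugHom.val f a * eval c (D.diff (word K l)))) := by
      have hs : ∀ Z : Augmentation D, sgn K (D.gr a) * Z.hom (gen K a) = Z.hom (gen K a) := by
        intro Z
        by_cases h : D.gr a = 0
        · rw [h, sgn_zero, one_mul]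
        · rw [Z.hom_degree a h, mul_zero]
      have hw : gen K a = word K [a] := rfl
      rw [eval_mul]
      cases c with
      | nil =>
        simp only [sumSplit, eval_nil, smul_eq_mul, ← mul_assoc, hs, add_zero]
      | @cons _ _ _ k f c =>
        have hf : sgn K (D.gr a) * AugHom.val f a = sgn K (k - 1) * AugHom.val f a := by
          rw [AugHom.val]
          split_ifs with h
          · rw [show k - 1 = D.gr a by omega]
          · simp
        simp only [sumSplit, eval_nil, smul_eq_mul, mul_add, ← mul_assoc, hs]
        congr 1
        cases c with
        | nil =>
          simp [sumSplit, hw, eval_word, evalWord, ← mul_assoc, hf]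
        | cons g c =>
          simp only [sumSplit, hw, eval_word, evalWord, mul_zero, zero_mul, zero_add, zero,
            add_zero, mul_one, ← mul_assoc, hf]
    rw [h2, ih]
    cases c with
    | nil =>
      simp only [sumSplit₃, sumSplit, append, evalWord, beta_val, eval_word, add_zero]
      simp only [red, sgn_zero]
      ring
    | cons f c =>
      simp only [ih, sumSplit₃, sumSplit, append, evalWord, beta_val, eval_word]
      simp only [red, sgn_zero, one_mul, sumSplit_add, mul_add, mul_sumSplit, sgn_add, mul_assoc,
        mul_left_comm]
      ring

theorem evalWord_multilinear_aux {Z X : Augmentation D} {Y W : Augmentation D} {k : ℤ}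
    (u : Chain (AugHom D) Z Y) (r : K) (a b : AugHom D Y W k) (v : Chain (AugHom D) W X)
    (l : List D.Gen) :
    evalWord (u.append (cons (r • a + b) v)) l =
      r * evalWord (u.append (cons a v)) l + evalWord (u.append (cons b v)) l := by
  have hval : ∀ x, AugHom.val (r • a + b) x = r * AugHom.val a x + AugHom.val b x := by
    intro x
    simp only [AugHom.val]
    split_ifs <;> simp
  induction l generalizing Z u with
  | nil => cases u <;> simp [append, evalWord]
  | cons x l ih =>
    cases u with
    | nil =>
      have := ih (nil _)
      simp only [append] at this
      simp only [append, evalWord, this, hval]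
      ring
    | cons f u =>
      have := ih (cons f u)
      simp only [append] at this
      simp only [append, evalWord, this, ih]
      ring

theorem eval_multilinear_aux {Z X : Augmentation D} {Y W : Augmentation D} {k : ℤ}
    (u : Chain (AugHom D) Z Y) (r : K) (a b : AugHom D Y W k) (v : Chain (AugHom D) W X)
    (x : WordAlg K D.Gen) :
    eval (u.append (cons (r • a + b) v)) x =
      r * eval (u.append (cons a v)) x + eval (u.append (cons b v)) x := by
  refine linearMap_ext_word (f := eval (u.append (cons (r • a + b) v)))
    (g := r • eval (u.append (cons a v)) + eval (u.append (cons b v))) (fun l => ?_) x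
  simp only [LinearMap.add_apply, LinearMap.smul_apply, eval_word, evalWord_multilinear_aux,
    smul_eq_mul]

theorem augMu_multilinear (Y X : Augmentation D) (q : ℤ) :
    IsMultilinear K fun c : Chain (AugHom D) Y X => augMu c q where
  map_add u a b v := by
    funext x
    have := eval_multilinear_aux u 1 a b v (D.diff (gen K x.1))
    simp only [one_smul, one_mul] at this
    simp only [augMu, Pi.add_apply, this, red_append, red]
    ring
  map_smul := by
    intro Y' W k u r a v
    funext x
    have h0 := eval_multilinear_aux (k := k) u (1 : K) 0 0 v (D.diff (gen K x.1))
    simp only [smul_zero, add_zero, one_mul, left_eq_add] at h0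
    have := eval_multilinear_aux u r a 0 v (D.diff (gen K x.1))
    rw [add_zero, h0, add_zero] at this
    simp only [augMu, Pi.smul_apply, this, red_append, red, smul_eq_mul]
    ring

theorem augMu_eq_beta {Y X : Augmentation D} (c : Chain (AugHom D) Y X) :
    augMu c (c.red + 2) = sgn K c.red • beta c := rfl

theorem eval_diff {Y X : Augmentation D} (c : Chain (AugHom D) Y X) (x : WordAlg K D.Gen) :
    eval c (D.diff x) = c.sumSplit₃ fun _ _ u m v =>
      sgn K u.red * eval (u.append (cons (beta m) v)) x := by
  induction x using MonoidAlgebra.induction_linear with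
  | zero =>
    simp only [sumSplit₃, map_zero, mul_zero]
    have h : ∀ {Z X : Augmentation D} (c : Chain (AugHom D) Z X),
        (c.sumSplit fun _ _ _ => (0 : K)) = 0 := fun c => by
      have := mul_sumSplit (0 : K) c fun _ _ _ => 0
      simpa using this.symm
    simp only [h]
  | add x y hx hy => simp only [map_add, hx, hy, mul_add, sumSplit₃, sumSplit_add]
  | single m r =>
    have h1 : (MonoidAlgebra.single m r : WordAlg K D.Gen) = r • word K m.toList := by
      simp [word]
    simp only [h1, map_smul, evalWord_diff, sumSplit₃, smul_eq_mul, mul_sumSplit, eval_word,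
      mul_left_comm]

theorem augMu_relation {Y X : Augmentation D} (c : Chain (AugHom D) Y X) (q : ℤ) :
    (c.sumSplit₃ fun _ _ u m v =>
      sgn K v.red • augMu (u.append (cons (augMu m (m.red + 2)) v)) q) = 0 := by
  funext x
  have key := eval_diff c (D.diff (gen K x.1))
  rw [D.diff_diff, map_zero] at key
  have hpi : ∀ {Z W : Augmentation D} (c : Chain (AugHom D) Z W)
      (φ : ∀ T, Chain (AugHom D) Z T → Chain (AugHom D) T W → AugHom D Y X q),
      c.sumSplit φ x = c.sumSplit fun T u v => φ T u v x := fun c φ =>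
    map_sumSplit (Pi.evalAddMonoidHom (fun _ => K) x) c φ
  simp only [sumSplit₃, hpi]
  simp only [Pi.zero_apply]
  rw [← mul_zero (sgn K (c.red + 1) * sgn K c.red), key, sumSplit₃, mul_sumSplit]
  refine sumSplit_congr _ _ _ fun T u t hut => ?_
  rw [mul_sumSplit]
  refine sumSplit_congr _ _ _ fun W m v hmv => ?_
  have h0 := (augMu_multilinear (D := D) Y X q).map_smul u (sgn K m.red) (beta m) v
  rw [augMu_eq_beta, h0]
  simp only [Pi.smul_apply, smul_eq_mul, augMu, red_append, red]
  have e1 : u.red + (m.red + 2 - 1 + v.red) = c.red + 1 := by omega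
  have e2 : sgn K v.red * sgn K m.red = sgn K c.red * sgn K u.red := by
    rw [← hut, ← hmv, sgn_add, sgn_add]
    linear_combination (-(sgn K v.red * sgn K m.red)) * sgn_mul_self K u.red
  rw [e1, ← mul_assoc, e2]
  ring

/-- The augmentation category of a semi-free DGA: its objects are the augmentations, its morphism
spaces are the graded dual `C^*(A)`, with the operations `μ^d` given by `augMu`. -/
noncomputable def Aug (D : SemiFreeDGA.{u} K) : AInfCat.{max u w, max u w} K where
  Ob := Augmentation D
  Hom := AugHom D
  mu := augMu
  mu_nil X q := by
    funext x
    simp only [augMu, eval_nil, X.hom_diff, mul_zero, Pi.zero_apply]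
  mu_degree c q hq := by
    funext x
    have := x.2
    rw [augMu, eval_degree c (D.gr x.1 - 1) _ (D.diff_homog _ _ (isHomog_gen D.gr x.1)) (by omega),
      mul_zero, Pi.zero_apply]
  mu_multilinear := augMu_multilinear
  mu_relation := augMu_relation

end Aug

end AInf

/-! A DGA morphism g : D' → D pulls augmentations of D back to D' and sends a chain (f_d, …, f_1) of
forms to the form a ↦ (f_d, …, f_1)(g a), a chain being evaluated on the free algebra as in the
definition of μ. The chain rule `eval_comp` says that evaluating a chain on g(x) means cutting it
into blocks in all ways, replacing each block by its image and evaluating the result on x. Combined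
with `eval_diff` and g∂ = ∂g, it is the A∞-functor equation. So g gives `pullFunctor g` from Aug(D)
to Aug(D').

The functor used comes from the composite D' ⊂ D₁' ≅ D₁ → D, where D₁ and D₁' are the isomorphic
stabilisations, the first arrow is the inclusion and the last one kills the new generators. Its
linear part is the pull-back of forms. This is an isomorphism on cohomology for the inclusion,
because the new generators cancel in pairs (`isQuasiIso_incl`); for the projection, a left inverse
of the inclusion; for the isomorphism; and so for the composite.

For objects, extend E in Aug(D') to an augmentation Y of D₁, and let Y' agree with Y on the old
generators and vanish on the new ones. The pull-back of Y' to D' is in the image of the functor,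
that of Y is E, and Y, Y' are homotopic: h(c_i) = Y(b_i), and h = 0 on the other generators,
satisfies h∂ = Y - Y'. Any homotopy defines a morphism of Yoneda modules, namely the identity up to
sign plus μ(h, …) (`homotopyMap_relation`). On D₁ its linear part is the identity up to sign, since
μ²(h, ·) = 0 for this h. The pulled-back homotopy has a linear part that differs, on cocycles, from
the pull-back of this identity by a coboundary made from F²(h, f), and therefore also induces
isomorphisms (`pseudoIsomorphic_pull`). -/

namespace AInf

open Chain

/-! ### Cutting chains into pieces -/

namespace Chain

variable {Ob : Type u} {Hom : Ob → Ob → ℤ → Type v}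

theorem append_nil {Z X : Ob} (c : Chain Hom Z X) : c.append (nil X) = c := by
  induction c with
  | nil X => rfl
  | cons a c ih => rw [append, ih]

theorem append_assoc {Z Y W X : Ob} (a : Chain Hom Z Y) (b : Chain Hom Y W) (c : Chain Hom W X) :
    (a.append b).append c = a.append (b.append c) := by
  induction a with
  | nil X => rfl
  | cons x a ih => rw [append, append, append, ih]

theorem sumSplit_zero {M : Type w} [AddCommMonoid M] {Z X : Ob} (c : Chain Hom Z X) :
    (c.sumSplit fun _ _ _ => (0 : M)) = 0 := by
  induction c with
  | nil X => rfl
  | cons a c ih => rw [sumSplit, ih, add_zero]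

/-- If only the empty initial piece contributes, there is only one term. -/
theorem sumSplit_eq_left {M : Type w} [AddCommMonoid M] {Z X : Ob} (c : Chain Hom Z X)
    (φ : ∀ Y : Ob, Chain Hom Z Y → Chain Hom Y X → M)
    (h : ∀ (Y W : Ob) (k : ℤ) (a : Hom Z W k) (u : Chain Hom W Y) (v : Chain Hom Y X),
      φ Y (cons a u) v = 0) : c.sumSplit φ = φ Z (nil Z) c := by
  cases c with
  | nil X => rfl
  | cons a c => simp only [sumSplit, h, sumSplit_zero, add_zero]

/-- If only the empty final piece contributes, there is only one term. -/
theorem sumSplit_eq_right {M : Type w} [AddCommMonoid M] {Z X : Ob} (c : Chain Hom Z X)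
    (φ : ∀ Y : Ob, Chain Hom Z Y → Chain Hom Y X → M)
    (h : ∀ (Y W : Ob) (k : ℤ) (u : Chain Hom Z Y) (a : Hom Y W k) (v : Chain Hom W X),
      φ Y u (cons a v) = 0) : c.sumSplit φ = φ X c (nil X) := by
  induction c with
  | nil X => rfl
  | cons a c ih =>
    rw [sumSplit, h, zero_add]
    exact ih _ fun Y W k u b v => h _ _ _ _ _ _

end Chain

/-! ### Sums over decompositions into blocks -/

section Blocks

variable {Ob : Type u} {Hom : Ob → Ob → ℤ → Type v} {Ob' : Type u'} {Hom' : Ob' → Ob' → ℤ → Type v'}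
  (F : Ob → Ob') (Fm : ∀ {Y X : Ob}, Chain Hom Y X → ∀ q : ℤ, Hom' (F Y) (F X) q)

/-- Sorts the decompositions by the end of the block being read: u is what that block still absorbs,
and v is cut freely. -/
theorem sumBlocksAux_eq {M : Type w} [AddCommMonoid M] {Z Y X : Ob} (m : Chain Hom Z Y)
    (c : Chain Hom Y X) (φ : Chain Hom' (F Z) (F X) → M) :
    sumBlocksAux F Fm m c φ = c.sumSplit fun _ u v =>
      sumBlocks F Fm v fun t => φ (cons (Fm (m.append u) ((m.append u).red + 1)) t) := by
  induction c generalizing Z with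
  | nil X => rw [sumBlocksAux, sumSplit, sumBlocks, append_nil, single]
  | cons a c ih =>
    rw [sumBlocksAux, ih (m.append (single a)), sumSplit, add_comm, append_nil, sumBlocks]
    congr 1
    exact congrArg c.sumSplit (funext fun Y => funext fun u => funext fun v => by
      rw [append_assoc]; rfl)

theorem sumBlocks_cons {M : Type w} [AddCommMonoid M] {Z Y X : Ob} {k : ℤ} (a : Hom Z Y k)
    (c : Chain Hom Y X) (φ : Chain Hom' (F Z) (F X) → M) :
    sumBlocks F Fm (cons a c) φ = c.sumSplit fun _ u v =>
      sumBlocks F Fm v fun t => φ (cons (Fm (cons a u) ((cons a u).red + 1)) t) :=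
  sumBlocksAux_eq F Fm (single a) c φ

theorem map_sumBlocksAux {M : Type w} {N : Type*} [AddCommMonoid M] [AddCommMonoid N]
    (g : M →+ N) {Z Y X : Ob} (m : Chain Hom Z Y)
    (c : Chain Hom Y X) (φ : Chain Hom' (F Z) (F X) → M) :
    g (sumBlocksAux F Fm m c φ) = sumBlocksAux F Fm m c fun t => g (φ t) := by
  induction c generalizing Z with
  | nil X => rfl
  | cons a c ih => simp only [sumBlocksAux, map_add, ih]

theorem map_sumBlocks {M : Type w} {N : Type*} [AddCommMonoid M] [AddCommMonoid N]
    (g : M →+ N) {Z X : Ob} (c : Chain Hom Z X) (φ : Chain Hom' (F Z) (F X) → M) :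
    g (sumBlocks F Fm c φ) = sumBlocks F Fm c fun t => g (φ t) := by
  cases c with
  | nil X => rfl
  | cons a c => exact map_sumBlocksAux F Fm g _ _ _

theorem mul_sumBlocks {R : Type w} [CommRing R] {Z X : Ob} (r : R) (c : Chain Hom Z X)
    (φ : Chain Hom' (F Z) (F X) → R) :
    r * sumBlocks F Fm c φ = sumBlocks F Fm c fun t => r * φ t :=
  map_sumBlocks F Fm (AddMonoidHom.mulLeft r) c φ

theorem sumBlocks_zero {M : Type w} [AddCommMonoid M] {Z X : Ob} (c : Chain Hom Z X) :
    (sumBlocks F Fm c fun _ => (0 : M)) = 0 :=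
  (map_sumBlocks F Fm (0 : M →+ M) c fun _ => 0).symm

theorem sumBlocksAux_add {M : Type w} [AddCommMonoid M] {Z Y X : Ob} (m : Chain Hom Z Y)
    (c : Chain Hom Y X) (φ ψ : Chain Hom' (F Z) (F X) → M) :
    (sumBlocksAux F Fm m c fun t => φ t + ψ t) =
      sumBlocksAux F Fm m c φ + sumBlocksAux F Fm m c ψ := by
  induction c generalizing Z with
  | nil X => rfl
  | cons a c ih => simp only [sumBlocksAux, ih]; abel

theorem sumBlocks_add {M : Type w} [AddCommMonoid M] {Z X : Ob}
    (c : Chain Hom Z X) (φ ψ : Chain Hom' (F Z) (F X) → M) :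
    (sumBlocks F Fm c fun t => φ t + ψ t) = sumBlocks F Fm c φ + sumBlocks F Fm c ψ := by
  cases c with
  | nil X => rfl
  | cons a c => exact sumBlocksAux_add F Fm _ _ _ _

theorem sumBlocksAux_congr {M : Type w} [AddCommMonoid M] {Z Y X : Ob} (m : Chain Hom Z Y)
    (c : Chain Hom Y X) (φ ψ : Chain Hom' (F Z) (F X) → M)
    (h : ∀ t, t.red = m.red + c.red → φ t = ψ t) :
    sumBlocksAux F Fm m c φ = sumBlocksAux F Fm m c ψ := by
  induction c generalizing Z with
  | nil X => exact h _ (by simp [single, red])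
  | cons a c ih =>
    rw [sumBlocksAux, sumBlocksAux]
    congr 1
    · exact ih _ _ _ fun t ht => h t (by rw [ht, red_append]; simp only [single, red]; ring)
    · exact ih _ _ _ fun t ht => h _ (by simp only [red, ht, single]; ring)

/-- Each block is replaced by an entry of the same reduced degree, so only chains t with the reduced
degree of c occur. This lets a sign depending on `t.red` leave the sum. -/
theorem sumBlocks_congr {M : Type w} [AddCommMonoid M] {Z X : Ob}
    (c : Chain Hom Z X) (φ ψ : Chain Hom' (F Z) (F X) → M)
    (h : ∀ t, t.red = c.red → φ t = ψ t) : sumBlocks F Fm c φ = sumBlocks F Fm c ψ := by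
  cases c with
  | nil X => exact h _ rfl
  | cons a c =>
    exact sumBlocksAux_congr F Fm _ _ _ _ fun t ht => h t (by rw [ht]; simp [single, red])

end Blocks

/-! ### Morphisms of semi-free DGAs -/

/-- A morphism of semi-free DGAs. -/
structure DGAHom {K : Type w} [Field K] (D : SemiFreeDGA.{u} K) (D' : SemiFreeDGA.{u'} K) where
  hom : WordAlg K D.Gen →ₐ[K] WordAlg K D'.Gen
  homog : ∀ (n : ℤ) (x : WordAlg K D.Gen), IsHomog D.gr n x → IsHomog D'.gr n (hom x)
  comm : ∀ x : WordAlg K D.Gen, hom (D.diff x) = D'.diff (hom x)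

/-! ### Pull-back of augmentations and the induced A∞-functor -/

section Pull

variable {K : Type w} [Field K] {D : SemiFreeDGA.{u} K} {D' : SemiFreeDGA.{u'} K}

theorem Augmentation.ext {Y X : Augmentation D} (h : ∀ x, Y.hom x = X.hom x) : Y = X := by
  cases Y
  cases X
  congr
  exact AlgHom.ext h

theorem Augmentation.hom_of_homog (Y : Augmentation D) {n : ℤ} (hn : n ≠ 0) {x : WordAlg K D.Gen}
    (hx : IsHomog D.gr n x) : Y.hom x = 0 := by
  rw [← eval_nil]
  exact eval_degree _ n x hx hn

/-- The pull-back of an augmentation along a morphism of DGAs. -/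
noncomputable def Augmentation.pull (g : DGAHom D' D) (Y : Augmentation D) : Augmentation D' where
  hom := Y.hom.comp g.hom
  hom_degree a ha := Y.hom_of_homog ha (g.homog _ _ (isHomog_gen _ a))
  hom_diff x := by rw [AlgHom.comp_apply, g.comm, Y.hom_diff]

@[simp]
theorem Augmentation.pull_apply (g : DGAHom D' D) (Y : Augmentation D) (x : WordAlg K D'.Gen) :
    (Y.pull g).hom x = Y.hom (g.hom x) := rfl

/-- The components of the functor induced by a morphism of DGAs. -/
noncomputable def pullMap (g : DGAHom D' D) : {Y X : Augmentation D} → Chain (AugHom D) Y X →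
    ∀ q : ℤ, AugHom D' (Y.pull g) (X.pull g) q
  | _, _, nil _, _ => 0
  | _, _, cons f c, _ => fun a => eval (cons f c) (g.hom (gen K a.1))

/-- The condition on q is what makes the formula hold for every generator: those of the wrong degree
give zero on the right as well, because g preserves degrees. -/
theorem pullMap_val (g : DGAHom D' D) {Z Y X : Augmentation D} {k : ℤ} (f : AugHom D Z Y k)
    (c : Chain (AugHom D) Y X) (q : ℤ) (hq : q = (cons f c).red + 1) (a : D'.Gen) :
    AugHom.val (pullMap g (cons f c) q) a = eval (cons f c) (g.hom (gen K a)) := by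
  rw [AugHom.val]
  split_ifs with h
  · rfl
  · exact (eval_degree _ (D'.gr a) _ (g.homog _ _ (isHomog_gen D'.gr a)) (by omega)).symm

theorem pullMap_append_cons (g : DGAHom D' D) {Z Y W X : Augmentation D} {k : ℤ}
    (u : Chain (AugHom D) Z Y) (f : AugHom D Y W k) (v : Chain (AugHom D) W X) (q : ℤ) :
    pullMap g (u.append (cons f v)) q = fun a => eval (u.append (cons f v)) (g.hom (gen K a.1)) := by
  cases u <;> rfl

/-- Induction on the word. In g(a)g(l), the factor g(a) uses up an initial piece of the chain. If
the piece is empty, g(a) contributes its value under the pulled-back augmentation; otherwise it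
contributes the image of that piece, as a first block, evaluated at a. -/
theorem evalWord_comp (g : DGAHom D' D) {Y X : Augmentation D} (c : Chain (AugHom D) Y X)
    (l : List D'.Gen) :
    eval c (g.hom (word K l)) =
      sumBlocks (Augmentation.pull g) (pullMap g) c fun t => evalWord t l := by
  induction l generalizing Y c with
  | nil =>
    have h1 : word K ([] : List D'.Gen) = 1 := rfl
    have h2 : word K ([] : List D.Gen) = 1 := rfl
    rw [h1, map_one, ← h2, eval_word]
    cases c with
    | nil X => rfl
    | cons f c =>
      rw [sumBlocks_cons]
      simp only [evalWord, sumBlocks_zero, sumSplit_zero]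
  | cons a l ih =>
    rw [word_cons, map_mul, eval_mul]
    cases c with
    | nil X => simp only [sumSplit, sumBlocks, evalWord, ih, eval_nil, Augmentation.pull_apply]
    | cons f c =>
      simp only [sumSplit]
      -- Both sides become sums over the end of the first block. The two summands correspond to the
      -- first letter being augmented or being fed to that block.
      rw [ih (cons f c), sumBlocks_cons, sumBlocks_cons, mul_sumSplit, ← sumSplit_add]
      refine sumSplit_congr _ _ _ fun W u v _ => ?_
      simp only [evalWord, sumBlocks_add, ← mul_sumBlocks, ih v, pullMap_val, eval_nil,
        Augmentation.pull_apply]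

theorem eval_comp (g : DGAHom D' D) {Y X : Augmentation D} (c : Chain (AugHom D) Y X)
    (x : WordAlg K D'.Gen) :
    eval c (g.hom x) = sumBlocks (Augmentation.pull g) (pullMap g) c fun t => eval t x := by
  induction x using MonoidAlgebra.induction_linear with
  | zero => simp only [map_zero, sumBlocks_zero]
  | add x y hx hy => simp only [map_add, hx, hy, sumBlocks_add]
  | single m r =>
    have h1 : (MonoidAlgebra.single m r : WordAlg K D'.Gen) = r • word K m.toList := by
      simp [word]
    simp only [h1, map_smul, evalWord_comp, smul_eq_mul, mul_sumBlocks, eval_word]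

theorem eval_smul_middle {Z X Y W : Augmentation D} {k : ℤ}
    (u : Chain (AugHom D) Z Y) (r : K) (a : AugHom D Y W k) (v : Chain (AugHom D) W X)
    (x : WordAlg K D.Gen) :
    eval (u.append (cons (r • a) v)) x = r * eval (u.append (cons a v)) x := by
  have h0 := eval_multilinear_aux (k := k) u (1 : K) 0 0 v x
  simp only [smul_zero, add_zero, one_mul, left_eq_add] at h0
  have := eval_multilinear_aux u r a 0 v x
  rwa [add_zero, h0, add_zero] at this

theorem eval_add_middle {Z X Y W : Augmentation D} {k : ℤ}
    (u : Chain (AugHom D) Z Y) (a b : AugHom D Y W k) (v : Chain (AugHom D) W X)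
    (x : WordAlg K D.Gen) :
    eval (u.append (cons (a + b) v)) x =
      eval (u.append (cons a v)) x + eval (u.append (cons b v)) x := by
  have := eval_multilinear_aux u (1 : K) a b v x
  rwa [one_smul, one_mul] at this

theorem eval_zero_middle {Z X Y W : Augmentation D} {k : ℤ}
    (u : Chain (AugHom D) Z Y) (v : Chain (AugHom D) W X) (x : WordAlg K D.Gen) :
    eval (u.append (cons (0 : AugHom D Y W k) v)) x = 0 := by
  have := eval_smul_middle (k := k) u (0 : K) 0 v x
  rwa [zero_smul, zero_mul] at this

theorem pullMap_degree (g : DGAHom D' D) {Y X : Augmentation D} (c : Chain (AugHom D) Y X) (q : ℤ)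
    (hq : q ≠ c.red + 1) : pullMap g c q = 0 := by
  cases c with
  | nil X => rfl
  | cons f c =>
    funext x
    have := x.2
    exact eval_degree _ (D'.gr x.1) _ (g.homog _ _ (isHomog_gen D'.gr x.1)) (by omega)

theorem pullMap_multilinear (g : DGAHom D' D) (Y X : Augmentation D) (q : ℤ) :
    IsMultilinear K fun c : Chain (AugHom D) Y X => pullMap g c q where
  map_add u a b v := by
    simp only [pullMap_append_cons]
    funext x
    exact eval_add_middle u a b v _
  map_smul u r a v := by
    simp only [pullMap_append_cons]
    funext x
    exact eval_smul_middle u r a v _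

theorem sumSplit_apply {Y' X' : Augmentation D'} {Z W : Augmentation D} {q : ℤ}
    (c : Chain (AugHom D) Z W)
    (φ : ∀ T, Chain (AugHom D) Z T → Chain (AugHom D) T W → AugHom D' Y' X' q)
    (x : {a : D'.Gen // D'.gr a + 1 = q}) :
    c.sumSplit φ x = c.sumSplit fun T u v => φ T u v x :=
  map_sumSplit (Pi.evalAddMonoidHom (fun _ => K) x) c φ

/-- Up to the common sign of c, both sides evaluate c on g(∂a) = ∂(g a): the left by the chain rule
for g, the right by the Leibniz expansion of c along ∂. -/
theorem pullMap_relation (g : DGAHom D' D) {Y X : Augmentation D} (c : Chain (AugHom D) Y X)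
    (q : ℤ) : (sumBlocks (Augmentation.pull g) (pullMap g) c fun t => augMu t q) =
      c.sumSplit₃ fun _ _ u m v =>
        sgn K v.red • pullMap g (u.append (cons (augMu m (m.red + 2)) v)) q := by
  funext x
  refine (map_sumBlocks (Augmentation.pull g) (pullMap g)
    (Pi.evalAddMonoidHom (fun _ : {a : D'.Gen // D'.gr a + 1 = q} => K) x) c
    fun t => augMu t q).trans ?_
  simp only [sumSplit₃, sumSplit_apply, Pi.evalAddMonoidHom_apply, pullMap_append_cons,
    Pi.smul_apply]
  rw [sumBlocks_congr _ _ c _ (fun t => sgn K c.red * eval t (D'.diff (gen K x.1)))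
    fun t ht => by rw [augMu, ht], ← mul_sumBlocks, ← eval_comp, g.comm, eval_diff, sumSplit₃,
    mul_sumSplit]
  refine sumSplit_congr _ _ _ fun T u t hut => ?_
  rw [mul_sumSplit]
  refine sumSplit_congr _ _ _ fun W m v hmv => ?_
  rw [augMu_eq_beta, eval_smul_middle, smul_eq_mul, ← hut, ← hmv, sgn_add, sgn_add]
  linear_combination (sgn K m.red * sgn K v.red *
    eval (u.append (cons (beta m) v)) (g.hom (gen K x.1))) * sgn_mul_self K u.red

/-- The `A_∞`-functor between augmentation categories induced by a morphism of DGAs. -/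
noncomputable def pullFunctor (g : DGAHom D' D) : AInfFunctor (Aug D) (Aug D') where
  obj := Augmentation.pull g
  map := pullMap g
  map_nil _ _ := rfl
  map_degree := pullMap_degree g
  map_multilinear := pullMap_multilinear g
  map_relation := pullMap_relation g

end Pull

/-! ### A criterion for isomorphisms on cohomology -/

section InducesIso

variable {K : Type w} [Field K]

/-- An elementwise criterion for a graded linear map to induce an isomorphism on cohomology. -/
theorem inducesIso_of_elementwise (A : AInfCat.{u, v} K) (B : AInfCat.{u', v'} K) {Y X : A.Ob}
    {Y' X' : B.Ob} (φ : ∀ k : ℤ, A.Hom Y X k →ₗ[K] B.Hom Y' X' k)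
    (hZ : ∀ k x, A.d Y X k (k + 1) x = 0 → B.d Y' X' k (k + 1) (φ k x) = 0)
    (hB : ∀ k x, (∃ h, x = A.d Y X (k - 1) k h) → ∃ h, φ k x = B.d Y' X' (k - 1) k h)
    (hinj : ∀ k x, A.d Y X k (k + 1) x = 0 → (∃ h, φ k x = B.d Y' X' (k - 1) k h) →
      ∃ h, x = A.d Y X (k - 1) k h)
    (hsurj : ∀ k y, B.d Y' X' k (k + 1) y = 0 → ∃ x, A.d Y X k (k + 1) x = 0 ∧
      ∃ h, y - φ k x = B.d Y' X' (k - 1) k h) :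
    InducesIso A B (Y := Y) (X := X) (Y' := Y') (X' := X') fun k a => φ k a := by
  intro k
  let f : A.cocycles Y X k →ₗ[K] B.cocycles Y' X' k :=
    ((φ k).comp (A.cocycles Y X k).subtype).codRestrict _ fun x => hZ k x.1 x.2
  have hf : ∀ x, ((f x : B.cocycles Y' X' k) : B.Hom Y' X' k) = φ k x.1 := fun x => rfl
  let g := Submodule.mapQ ((LinearMap.range (A.d Y X (k - 1) k)).comap (A.cocycles Y X k).subtype)
    ((LinearMap.range (B.d Y' X' (k - 1) k)).comap (B.cocycles Y' X' k).subtype) f (by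
      rintro x ⟨h, hh⟩
      obtain ⟨h', hh'⟩ := hB k x.1 ⟨h, hh.symm⟩
      exact ⟨h', hh'.symm⟩)
  refine ⟨LinearEquiv.ofBijective g ⟨?_, ?_⟩, fun x => ⟨hZ k x.1 x.2, rfl⟩⟩
  · rw [injective_iff_map_eq_zero]
    intro z hz
    obtain ⟨x, rfl⟩ := Submodule.Quotient.mk_surjective _ z
    rw [Submodule.mapQ_apply, Submodule.Quotient.mk_eq_zero] at hz
    obtain ⟨h', hh'⟩ := hz
    obtain ⟨h, hh⟩ := hinj k x.1 x.2 ⟨h', hh'.symm⟩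
    rw [Submodule.Quotient.mk_eq_zero]
    exact ⟨h, hh.symm⟩
  · intro z
    obtain ⟨y, rfl⟩ := Submodule.Quotient.mk_surjective _ z
    obtain ⟨x, hx, h, hh⟩ := hsurj k y.1 y.2
    refine ⟨Submodule.Quotient.mk ⟨x, hx⟩, ?_⟩
    rw [Submodule.mapQ_apply, eq_comm, Submodule.Quotient.eq]
    exact ⟨h, hh.symm⟩

end InducesIso

/-! ### Cocycles, coboundaries and quasi-isomorphisms -/

section Cohomology

variable {K : Type w} [Field K] {D : SemiFreeDGA.{u} K} {D' : SemiFreeDGA.{u'} K}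
  {D'' : SemiFreeDGA.{v'} K}

theorem eval_single_add {Y X : Augmentation D} {k : ℤ} (f g : AugHom D Y X k)
    (x : WordAlg K D.Gen) : eval (single (f + g)) x = eval (single f) x + eval (single g) x :=
  eval_add_middle (nil Y) f g (nil X) x

theorem eval_single_smul {Y X : Augmentation D} {k : ℤ} (r : K) (f : AugHom D Y X k)
    (x : WordAlg K D.Gen) : eval (single (r • f)) x = r * eval (single f) x :=
  eval_smul_middle (nil Y) r f (nil X) x

theorem eval_single_zero {Y X : Augmentation D} {k : ℤ} (x : WordAlg K D.Gen) :
    eval (single (0 : AugHom D Y X k)) x = 0 :=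
  eval_zero_middle (nil Y) (nil X) x

theorem eval_single_sub {Y X : Augmentation D} {k : ℤ} (f g : AugHom D Y X k)
    (x : WordAlg K D.Gen) : eval (single (f - g)) x = eval (single f) x - eval (single g) x := by
  have h : f - g = f + (-1 : K) • g := by rw [neg_one_smul, sub_eq_add_neg]
  rw [h, eval_single_add, eval_single_smul]
  ring

theorem eval_single_gen {Y X : Augmentation D} {k : ℤ} (f : AugHom D Y X k) (a : D.Gen) :
    eval (single f) (gen K a) = AugHom.val f a := by
  have : gen K a = word K [a] := rfl
  rw [this, eval_word]
  simp [single, evalWord]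

theorem eval_cons_cons_gen {Z Y W X : Augmentation D} {k l : ℤ} (f : AugHom D Z Y k)
    (g : AugHom D Y W l) (c : Chain (AugHom D) W X) (a : D.Gen) :
    eval (cons f (cons g c)) (gen K a) = 0 := by
  have : gen K a = word K [a] := rfl
  rw [this, eval_word]
  simp [evalWord]

theorem AugHom.val_coe {Y X : Augmentation D} {k : ℤ} (f : AugHom D Y X k)
    (a : {a : D.Gen // D.gr a + 1 = k}) : AugHom.val f a.1 = f a := by
  rw [AugHom.val, dif_pos a.2]

theorem AugHom.ext_val {Y X : Augmentation D} {k : ℤ} {f g : AugHom D Y X k}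
    (h : ∀ a, AugHom.val f a = AugHom.val g a) : f = g := by
  funext a
  rw [← AugHom.val_coe f, ← AugHom.val_coe g, h]

theorem beta_nil (X : Augmentation D) : beta (nil X) = 0 := by
  funext a
  simp only [beta, eval_nil, X.hom_diff, Pi.zero_apply]

/-- The form `a ↦ f(∂a)`, i.e. `μ^1(f)` up to sign. -/
noncomputable def coboundary {Y X : Augmentation D} {k : ℤ} (f : AugHom D Y X k) (l : ℤ) :
    AugHom D Y X l :=
  fun a => eval (single f) (D.diff (gen K a.1))

/-- The case of a single form in `eval_diff`: the pieces with empty middle vanish because an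
augmentation kills ∂. Hence the identities defining cocycles and coboundaries need only be checked
on generators. -/
theorem eval_coboundary {Y X : Augmentation D} {k l : ℤ} (f : AugHom D Y X k) (hl : l = k + 1)
    (x : WordAlg K D.Gen) : eval (single (coboundary f l)) x = eval (single f) (D.diff x) := by
  obtain rfl : l = (single f).red + 2 := by rw [hl]; simp only [single, red]; ring
  have h : coboundary f ((single f).red + 2) = beta (single f) := rfl
  rw [h, eval_diff]
  simp only [single, sumSplit₃, sumSplit, append, beta_nil, red, sgn_zero, one_mul]
  have h1 := eval_zero_middle (k := (nil Y : Chain (AugHom D) Y Y).red + 2) (nil Y) (cons f (nil X)) x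
  have h2 := eval_zero_middle (k := (nil X : Chain (AugHom D) X X).red + 2) (cons f (nil X)) (nil X) x
  simp only [append, red] at h1 h2
  rw [h1, h2]
  ring

theorem coboundary_val {Y X : Augmentation D} {k l : ℤ} (f : AugHom D Y X k) (hl : l = k + 1)
    (a : D.Gen) : AugHom.val (coboundary f l) a = eval (single f) (D.diff (gen K a)) := by
  rw [← eval_single_gen, eval_coboundary f hl]

/-- `f` is a cocycle. -/
def IsCocycle {Y X : Augmentation D} {k : ℤ} (f : AugHom D Y X k) : Prop :=
  ∀ x, eval (single f) (D.diff x) = 0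

/-- `f` is a coboundary. -/
def IsCoboundary {Y X : Augmentation D} {k : ℤ} (f : AugHom D Y X k) : Prop :=
  ∃ h : AugHom D Y X (k - 1), ∀ x, eval (single f) x = eval (single h) (D.diff x)

theorem isCocycle_of_gen {Y X : Augmentation D} {k : ℤ} {f : AugHom D Y X k}
    (h : ∀ a, eval (single f) (D.diff (gen K a)) = 0) : IsCocycle f := by
  intro x
  have : coboundary f (k + 1) = 0 := funext fun a => h a.1
  rw [← eval_coboundary f rfl, this, eval_single_zero]

theorem isCoboundary_of_gen {Y X : Augmentation D} {k : ℤ} {f : AugHom D Y X k}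
    (h : AugHom D Y X (k - 1))
    (hf : ∀ a, AugHom.val f a = eval (single h) (D.diff (gen K a))) : IsCoboundary f := by
  refine ⟨h, fun x => ?_⟩
  have hk : k = k - 1 + 1 := by ring
  have : f = coboundary h k := AugHom.ext_val fun a => by rw [hf, coboundary_val h hk]
  rw [← eval_coboundary h hk, ← this]

theorem IsCoboundary.isCocycle {Y X : Augmentation D} {k : ℤ} {f : AugHom D Y X k}
    (h : IsCoboundary f) : IsCocycle f := by
  obtain ⟨g, hg⟩ := h
  intro x
  rw [hg, D.diff_diff, map_zero]

theorem isCoboundary_zero {Y X : Augmentation D} {k : ℤ} : IsCoboundary (0 : AugHom D Y X k) :=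
  ⟨0, fun x => by rw [eval_single_zero, eval_single_zero]⟩

theorem IsCoboundary.add {Y X : Augmentation D} {k : ℤ} {f g : AugHom D Y X k}
    (hf : IsCoboundary f) (hg : IsCoboundary g) : IsCoboundary (f + g) := by
  obtain ⟨h, hh⟩ := hf
  obtain ⟨h', hh'⟩ := hg
  exact ⟨h + h', fun x => by rw [eval_single_add, eval_single_add, hh, hh']⟩

theorem IsCoboundary.smul {Y X : Augmentation D} {k : ℤ} {f : AugHom D Y X k}
    (r : K) (hf : IsCoboundary f) : IsCoboundary (r • f) := by
  obtain ⟨h, hh⟩ := hf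
  exact ⟨r • h, fun x => by rw [eval_single_smul, eval_single_smul, hh]⟩

theorem IsCoboundary.sub {Y X : Augmentation D} {k : ℤ} {f g : AugHom D Y X k}
    (hf : IsCoboundary f) (hg : IsCoboundary g) : IsCoboundary (f - g) := by
  have h : f - g = f + (-1 : K) • g := by rw [neg_one_smul, sub_eq_add_neg]
  exact h ▸ hf.add (hg.smul _)

theorem IsCocycle.sub {Y X : Augmentation D} {k : ℤ} {f g : AugHom D Y X k}
    (hf : IsCocycle f) (hg : IsCocycle g) : IsCocycle (f - g) := fun x => by
  rw [eval_single_sub, hf, hg, sub_zero]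

theorem IsCocycle.smul {Y X : Augmentation D} {k : ℤ} {f : AugHom D Y X k} (r : K)
    (hf : IsCocycle f) : IsCocycle (r • f) := fun x => by
  rw [eval_single_smul, hf, mul_zero]

theorem sgn_smul_sgn_smul {M : Type v} [AddCommGroup M] [Module K M] (n : ℤ) (x : M) :
    sgn K n • sgn K n • x = x := by
  rw [smul_smul, sgn_mul_self, one_smul]

theorem augMu_single {Y X : Augmentation D} {k : ℤ} (f : AugHom D Y X k) (l : ℤ) :
    augMu (single f) l = sgn K (k - 1) • coboundary f l := by
  funext a
  simp only [augMu, coboundary, single, red, add_zero, Pi.smul_apply, smul_eq_mul]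

theorem augMu_single_eq_zero_iff {Y X : Augmentation D} {k : ℤ} (f : AugHom D Y X k) :
    augMu (single f) (k + 1) = 0 ↔ IsCocycle f := by
  rw [augMu_single]
  constructor
  · intro h x
    have h' := congrArg (sgn K (k - 1) • ·) h
    rw [sgn_smul_sgn_smul, smul_zero] at h'
    rw [← eval_coboundary f rfl, h', eval_single_zero]
  · intro h
    funext a
    have := h (gen K a.1)
    simp [coboundary, this]

theorem exists_eq_augMu_single_iff {Y X : Augmentation D} {k : ℤ} (f : AugHom D Y X k) :
    (∃ h : AugHom D Y X (k - 1), f = augMu (single h) k) ↔ IsCoboundary f := by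
  have hk : k = k - 1 + 1 := by ring
  constructor
  · rintro ⟨h, rfl⟩
    rw [augMu_single]
    exact IsCoboundary.smul _ ⟨h, eval_coboundary h hk⟩
  · rintro ⟨h, hh⟩
    refine ⟨sgn K (k - 1 - 1) • h, ?_⟩
    have h1 : coboundary (sgn K (k - 1 - 1) • h) k = sgn K (k - 1 - 1) • coboundary h k :=
      funext fun a => eval_single_smul _ h _
    rw [augMu_single, h1, sgn_smul_sgn_smul]
    exact AugHom.ext_val fun a => by rw [coboundary_val h hk, ← hh, eval_single_gen]

/-- A graded linear map between morphism spaces of augmentation categories induces an isomorphism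
on cohomology if it preserves cocycles and coboundaries, reflects coboundaries among the cocycles
and reaches each cocycle up to a coboundary. -/
theorem inducesIso_aug {Y X : Augmentation D} {Y' X' : Augmentation D'}
    (φ : ∀ k : ℤ, AugHom D Y X k →ₗ[K] AugHom D' Y' X' k)
    (hZ : ∀ k (f : AugHom D Y X k), IsCocycle f →
      IsCocycle (show AugHom D' Y' X' k from φ k f))
    (hB : ∀ k (f : AugHom D Y X k), IsCoboundary f →
      IsCoboundary (show AugHom D' Y' X' k from φ k f))
    (hinj : ∀ k (f : AugHom D Y X k), IsCocycle f →
      IsCoboundary (show AugHom D' Y' X' k from φ k f) → IsCoboundary f)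
    (hsurj : ∀ k (f' : AugHom D' Y' X' k), IsCocycle f' → ∃ f : AugHom D Y X k, IsCocycle f ∧
      IsCoboundary (show AugHom D' Y' X' k from f' - φ k f)) :
    InducesIso (Aug D) (Aug D') (Y := Y) (X := X) (Y' := Y') (X' := X') fun k a => φ k a := by
  refine inducesIso_of_elementwise (Aug D) (Aug D') φ ?_ ?_ ?_ ?_
  · intro k x hx
    exact (augMu_single_eq_zero_iff (D := _) _).2 (hZ k x ((augMu_single_eq_zero_iff (D := _) _).1 hx))
  · intro k x hx
    exact (exists_eq_augMu_single_iff (D := _) _).2 (hB k x ((exists_eq_augMu_single_iff (D := _) _).1 hx))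
  · intro k x hx hx'
    exact (exists_eq_augMu_single_iff (D := _) _).2 (hinj k x ((augMu_single_eq_zero_iff (D := _) _).1 hx)
      ((exists_eq_augMu_single_iff (D := _) _).1 hx'))
  · intro k y hy
    obtain ⟨f, hf, hf'⟩ := hsurj k y ((augMu_single_eq_zero_iff (D := _) _).1 hy)
    exact ⟨f, (augMu_single_eq_zero_iff (D := _) _).2 hf, (exists_eq_augMu_single_iff (D := _) _).2 hf'⟩

/-! ### The linear part of the functor induced by a morphism -/

/-- The pull-back of a form along `g`. -/
noncomputable def AugHom.pull (g : DGAHom D' D) {Y X : Augmentation D} {k : ℤ}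
    (f : AugHom D Y X k) : AugHom D' (Y.pull g) (X.pull g) k :=
  fun a => eval (single f) (g.hom (gen K a.1))

theorem AugHom.pull_val (g : DGAHom D' D) {Y X : Augmentation D} {k : ℤ} (f : AugHom D Y X k)
    (a : D'.Gen) : AugHom.val (f.pull g) a = eval (single f) (g.hom (gen K a)) := by
  have h := pullMap_val g f (nil X) k (by simp only [red]; ring) a
  exact h

/-- A chain with one entry has only one decomposition into blocks. -/
theorem eval_pull (g : DGAHom D' D) {Y X : Augmentation D} {k : ℤ} (f : AugHom D Y X k)
    (x : WordAlg K D'.Gen) : eval (single (f.pull g)) x = eval (single f) (g.hom x) := by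
  rw [eval_comp]
  have h : (single f).red + 1 = k := by simp only [single, red]; ring
  -- The degree (k - 1) + 0 + 1 equals k only propositionally, so it is generalised before
  -- substituting. The same device recurs below.
  have h2 : ∀ q, q = k → eval (single (pullMap g (single f) q)) x = eval (single (f.pull g)) x := by
    rintro q rfl
    rfl
  exact (h2 _ h).symm

theorem IsCocycle.pull (g : DGAHom D' D) {Y X : Augmentation D} {k : ℤ} {f : AugHom D Y X k}
    (hf : IsCocycle f) : IsCocycle (f.pull g) := fun x => by
  rw [eval_pull, g.comm, hf]

theorem IsCoboundary.pull (g : DGAHom D' D) {Y X : Augmentation D} {k : ℤ} {f : AugHom D Y X k}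
    (hf : IsCoboundary f) : IsCoboundary (f.pull g) := by
  obtain ⟨h, hh⟩ := hf
  exact ⟨h.pull g, fun x => by rw [eval_pull, eval_pull, g.comm, hh]⟩

theorem AugHom.pull_sub (g : DGAHom D' D) {Y X : Augmentation D} {k : ℤ} (f f' : AugHom D Y X k) :
    (f - f').pull g = f.pull g - f'.pull g :=
  funext fun _ => eval_single_sub f f' _

/-- `g` is a quasi-isomorphism, in the sense that the linear part of the functor induced by `g`
induces isomorphisms on cohomology for all pairs of augmentations. -/
structure IsQuasiIso (g : DGAHom D' D) : Prop where
  inj : ∀ {Y X : Augmentation D} {k : ℤ} (f : AugHom D Y X k), IsCocycle f →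
    IsCoboundary (f.pull g) → IsCoboundary f
  surj : ∀ {Y X : Augmentation D} {k : ℤ} (f' : AugHom D' (Y.pull g) (X.pull g) k), IsCocycle f' →
    ∃ f : AugHom D Y X k, IsCocycle f ∧ IsCoboundary (f' - f.pull g)

theorem IsQuasiIso.cohomFullyFaithful {g : DGAHom D' D} (hg : IsQuasiIso g) :
    (pullFunctor g).CohomFullyFaithful := by
  intro Y X
  exact inducesIso_aug (D := D) (D' := D') (Y := Y) (X := X) (Y' := Augmentation.pull g Y)
    (X' := Augmentation.pull g X)
    (fun k =>
      { toFun := AugHom.pull g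
        map_add' := fun f f' => funext fun _ => eval_single_add f f' _
        map_smul' := fun r f => funext fun _ => eval_single_smul r f _ })
    (fun _ _ h => h.pull g) (fun _ _ h => h.pull g) (fun _ f h h' => hg.inj f h h')
    (fun _ f' h => hg.surj f' h)

/-- The composition of morphisms of DGAs. -/
noncomputable def DGAHom.comp (g : DGAHom D' D) (h : DGAHom D'' D') : DGAHom D'' D where
  hom := g.hom.comp h.hom
  homog n x hx := g.homog n _ (h.homog n x hx)
  comm x := by simp only [AlgHom.comp_apply, h.comm, g.comm]

theorem AugHom.pull_comp (g : DGAHom D' D) (h : DGAHom D'' D') {Y X : Augmentation D} {k : ℤ}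
    (f : AugHom D Y X k) : f.pull (g.comp h) = (f.pull g).pull h :=
  funext fun _ => (eval_pull g f _).symm

theorem IsQuasiIso.comp {g : DGAHom D' D} {h : DGAHom D'' D'} (hg : IsQuasiIso g)
    (hh : IsQuasiIso h) : IsQuasiIso (g.comp h) where
  inj f hf hb := hg.inj f hf (hh.inj _ (hf.pull g) (by rwa [AugHom.pull_comp] at hb))
  surj {Y X k} f'' hf'' := by
    obtain ⟨f', hf', hb'⟩ := hh.surj (Y := Y.pull g) (X := X.pull g) f'' hf''
    obtain ⟨f, hf, hb⟩ := hg.surj f' hf'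
    refine ⟨f, hf, ?_⟩
    -- The two errors add up: f'' - h^*f' is exact, and so is the pull-back of f' - g^*f.
    have h1 := hb'.add (hb.pull h)
    rw [AugHom.pull_sub] at h1
    rw [AugHom.pull_comp]
    have e : f'' - (f.pull g).pull h = f'' - f'.pull h + (f'.pull h - (f.pull g).pull h) := by abel
    exact e ▸ h1

end Cohomology

theorem Chain.smul_sumSplit {K : Type w} [Field K] {Ob : Type u} {Hom : Ob → Ob → ℤ → Type v}
    {M : Type v'} [AddCommGroup M] [Module K M] {Z X : Ob} (r : K) (c : Chain Hom Z X)
    (φ : ∀ Y : Ob, Chain Hom Z Y → Chain Hom Y X → M) :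
    r • c.sumSplit φ = c.sumSplit fun Y u v => r • φ Y u v :=
  map_sumSplit (DistribSMul.toAddMonoidHom M r) c φ

/-! ### Homotopies of augmentations as morphisms of Yoneda modules -/

section Homotopy

variable {K : Type w} [Field K] {D : SemiFreeDGA.{u} K}

theorem AugHom.val_add {Y X : Augmentation D} {k : ℤ} (f g : AugHom D Y X k) (a : D.Gen) :
    AugHom.val (f + g) a = AugHom.val f a + AugHom.val g a := by
  rw [← eval_single_gen, eval_single_add, eval_single_gen, eval_single_gen]

theorem AugHom.val_smul {Y X : Augmentation D} {k : ℤ} (r : K) (f : AugHom D Y X k) (a : D.Gen) :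
    AugHom.val (r • f) a = r * AugHom.val f a := by
  rw [← eval_single_gen, eval_single_smul, eval_single_gen]

theorem AugHom.val_of_ne {Y X : Augmentation D} {k : ℤ} (f : AugHom D Y X k) {a : D.Gen}
    (h : D.gr a + 1 ≠ k) : AugHom.val f a = 0 := by
  rw [AugHom.val, dif_neg h]

/-- The same form, as a morphism between other augmentations. -/
def AugHom.retag (Y' X' : Augmentation D) {Y X : Augmentation D} {k : ℤ} (f : AugHom D Y X k) :
    AugHom D Y' X' k := f

theorem AugHom.retag_val (Y' X' : Augmentation D) {Y X : Augmentation D} {k : ℤ}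
    (f : AugHom D Y X k) (a : D.Gen) : AugHom.val (f.retag Y' X') a = AugHom.val f a := rfl

/-- A homotopy between the augmentations `Y'` and `Y`. -/
def IsHomotopy {Y' Y : Augmentation D} (h : AugHom D Y' Y 0) : Prop :=
  ∀ a : D.Gen, eval (single h) (D.diff (gen K a)) = Y.hom (gen K a) - Y'.hom (gen K a)

/-- Telescoping: for the prefix w read before f, the sum of Y'(w₁)(Y - Y')(b)Y(w₂) over all w =
w₁bw₂ is Y(w) - Y'(w). -/
theorem evalWord_difference {Y' Y X : Augmentation D} {n : ℤ} (κ : AugHom D Y' Y n)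
    (hκ : ∀ a, AugHom.val κ a = Y.hom (gen K a) - Y'.hom (gen K a)) {W : Augmentation D} {j : ℤ}
    (f : AugHom D Y W j) (c : Chain (AugHom D) W X) (l : List D.Gen) :
    evalWord (cons κ (cons f c)) l =
      evalWord (cons f c) l - evalWord (cons (f.retag Y' W) c) l := by
  induction l with
  | nil => simp [evalWord]
  | cons a l ih =>
    simp only [evalWord, AugHom.retag_val, hκ] at ih ⊢
    rw [ih]
    ring

/-- The derivation extending `Y - Y'` is `Y - Y'` itself. -/
theorem eval_difference {Y' Y X : Augmentation D} {n : ℤ} (κ : AugHom D Y' Y n)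
    (hκ : ∀ a, AugHom.val κ a = Y.hom (gen K a) - Y'.hom (gen K a)) {W : Augmentation D} {j : ℤ}
    (f : AugHom D Y W j) (c : Chain (AugHom D) W X) (x : WordAlg K D.Gen) :
    eval (cons κ (cons f c)) x =
      eval (cons f c) x - eval (cons (f.retag Y' W) c) x :=
  linearMap_ext_word (f := eval (cons κ (cons f c)))
    (g := eval (cons f c) - eval (cons (f.retag Y' W) c))
    (fun l => by
      rw [LinearMap.sub_apply, eval_word, eval_word, eval_word, evalWord_difference κ hκ]) x

theorem eval_single_difference {Y' Y : Augmentation D} {n : ℤ} (κ : AugHom D Y' Y n)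
    (hκ : ∀ a, AugHom.val κ a = Y.hom (gen K a) - Y'.hom (gen K a)) (x : WordAlg K D.Gen) :
    eval (single κ) x = Y.hom x - Y'.hom x := by
  refine linearMap_ext_word (f := eval (single κ))
    (g := Y.hom.toLinearMap - Y'.hom.toLinearMap) (fun l => ?_) x
  simp only [LinearMap.sub_apply, AlgHom.toLinearMap_apply, eval_word]
  induction l with
  | nil =>
    have : word K ([] : List D.Gen) = 1 := rfl
    simp [this, single, evalWord]
  | cons a l ih =>
    simp only [single] at ih ⊢
    rw [evalWord, ih, hκ, evalWord_nil, word_cons, map_mul, map_mul]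
    ring

theorem IsHomotopy.eval_diff {Y' Y : Augmentation D} {h : AugHom D Y' Y 0} (hh : IsHomotopy h)
    (x : WordAlg K D.Gen) : eval (single h) (D.diff x) = Y.hom x - Y'.hom x := by
  rw [← eval_coboundary h rfl, eval_single_difference]
  intro a
  rw [coboundary_val h rfl, hh a]

/-- The part of the morphism of Yoneda modules that comes from the identity. -/
noncomputable def leadTerm (Y' : Augmentation D) : {Y X : Augmentation D} →
    Chain (AugHom D) Y X → ∀ q : ℤ, AugHom D Y' X q
  | _, _, nil _, _ => 0
  | _, _, cons (k := j) f (nil _), _ => fun a => sgn K (j - 1) * AugHom.val f a.1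
  | _, _, cons _ (cons _ _), _ => 0

/-- The components of the morphism of Yoneda modules given by a homotopy. -/
noncomputable def homotopyMap {Y' : Augmentation D} : {Y X : Augmentation D} →
    AugHom D Y' Y 0 → Chain (AugHom D) Y X → ∀ q : ℤ, AugHom D Y' X q
  | _, _, _, nil _, _ => 0
  | _, _, h, cons f c, q => leadTerm Y' (cons f c) q + augMu (cons h (cons f c)) q

theorem homotopyMap_append_cons {Y' Y X Z W : Augmentation D} (h : AugHom D Y' Y 0)
    {k : ℤ} (u : Chain (AugHom D) Y Z) (f : AugHom D Z W k) (v : Chain (AugHom D) W X) (q : ℤ) :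
    homotopyMap h (u.append (cons f v)) q =
      leadTerm Y' (u.append (cons f v)) q + augMu (cons h (u.append (cons f v))) q := by
  cases u <;> rfl

theorem leadTerm_multilinear (Y' Y X : Augmentation D) (q : ℤ) :
    IsMultilinear K fun c : Chain (AugHom D) Y X => leadTerm Y' c q where
  map_add u a b v := by
    rcases u with _ | ⟨f, _ | _⟩
    · cases v
      · funext x
        simp only [append, leadTerm, AugHom.val_add, Pi.add_apply, mul_add]
      · exact (add_zero _).symm
    · exact (add_zero _).symm
    · exact (add_zero _).symm
  map_smul u r a v := by
    rcases u with _ | ⟨f, _ | _⟩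
    · cases v
      · funext x
        simp only [append, leadTerm, AugHom.val_smul, Pi.smul_apply, smul_eq_mul]
        ring
      · exact (smul_zero _).symm
    · exact (smul_zero _).symm
    · exact (smul_zero _).symm

theorem leadTerm_degree (Y' : Augmentation D) {Y X : Augmentation D} (c : Chain (AugHom D) Y X)
    (q : ℤ) (hq : q ≠ c.red + 1) : leadTerm Y' c q = 0 := by
  rcases c with _ | ⟨f, _ | _⟩
  · rfl
  · funext x
    have := x.2
    simp only [red] at hq
    simp only [leadTerm]
    rw [AugHom.val_of_ne f (by omega), mul_zero, Pi.zero_apply]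
  · rfl

theorem homotopyMap_degree {Y' Y X : Augmentation D} (h : AugHom D Y' Y 0)
    (c : Chain (AugHom D) Y X) (q : ℤ) (hq : q ≠ c.red + 1) : homotopyMap h c q = 0 := by
  cases c with
  | nil X => rfl
  | cons f c =>
    have h0 : q ≠ (cons h (cons f c)).red + 2 := by
      simp only [red] at hq ⊢
      omega
    have h1 : augMu (cons h (cons f c)) q = 0 := (Aug D).mu_degree (cons h (cons f c)) q h0
    rw [homotopyMap, leadTerm_degree _ _ _ hq, h1, add_zero]

theorem homotopyMap_multilinear {Y' Y : Augmentation D} (h : AugHom D Y' Y 0) (X : Augmentation D)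
    (q : ℤ) : IsMultilinear K fun c : Chain (AugHom D) Y X => homotopyMap h c q where
  map_add u a b v := by
    have h1 := (leadTerm_multilinear Y' Y X q).map_add u a b v
    have h2 := (augMu_multilinear Y' X q).map_add (cons h u) a b v
    simp only [append] at h2
    simp only [homotopyMap_append_cons, h1, h2]
    abel
  map_smul u r a v := by
    have h1 := (leadTerm_multilinear Y' Y X q).map_smul u r a v
    have h2 := (augMu_multilinear Y' X q).map_smul (cons h u) r a v
    simp only [append] at h2
    simp only [homotopyMap_append_cons, h1, h2, smul_add]

theorem augMu_cons_zero {Z Y X : Augmentation D} {k : ℤ} (c : Chain (AugHom D) Y X) (q : ℤ) :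
    augMu (cons (0 : AugHom D Z Y k) c) q = 0 := by
  have := (augMu_multilinear Z X q).map_smul (k := k) (nil Z) 0 0 c
  simpa only [append, zero_smul] using this

theorem augMu_nil (X : Augmentation D) (q : ℤ) : augMu (nil X) q = 0 := (Aug D).mu_nil X q

theorem augMu_cons_augMu_congr {Z Y X : Augmentation D} (m : Chain (AugHom D) Z Y)
    (c : Chain (AugHom D) Y X) {p p' : ℤ} (hp : p = p') (q : ℤ) :
    augMu (cons (augMu m p) c) q = augMu (cons (augMu m p') c) q := by
  rw [hp]

/-- The contribution of the first operation of the identity part. -/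
theorem sumSplit_leadTerm {Y' Y W X : Augmentation D} {j : ℤ} (f : AugHom D Y W j)
    (v : Chain (AugHom D) W X) (q : ℤ) :
    (v.sumSplit fun _ u w => sgn K ((cons f u).red + 1) •
      augMu (cons (leadTerm Y' (cons f u) ((cons f u).red + 1)) w) q) =
    -augMu (cons (f.retag Y' W) v) q := by
  rw [sumSplit_eq_left]
  · have h1 : leadTerm Y' (cons f (nil W)) j = sgn K (j - 1) • f.retag Y' W := by
      funext a
      simp only [leadTerm, Pi.smul_apply, smul_eq_mul]
      rw [AugHom.val_coe]
      rfl
    have h2 : ∀ p, p = j → augMu (cons (leadTerm Y' (cons f (nil W)) p) v) q =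
        sgn K (j - 1) • augMu (cons (f.retag Y' W) v) q := by
      rintro p rfl
      rw [h1]
      exact (augMu_multilinear Y' X q).map_smul (nil Y') _ _ _
    have h3 : (cons f (nil W)).red + 1 = j := by simp only [red]; ring
    rw [h2 _ h3, h3, smul_smul, ← sgn_add]
    have h4 : j + (j - 1) = (j - 1) + (j - 1) + 1 := by ring
    rw [h4, sgn_add, sgn_add, sgn_mul_self]
    simp [sgn]
  · intro V U k a u w
    rw [leadTerm, augMu_cons_zero, smul_zero]

/-- The contribution of the second operation of the identity part. -/
theorem sumSplit₃_leadTerm (Y' : Augmentation D) {Y X : Augmentation D}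
    (c : Chain (AugHom D) Y X) (q : ℤ) :
    (c.sumSplit₃ fun _ _ u m v => sgn K (u.red + m.red + 1) •
      leadTerm Y' (u.append (cons (augMu m (m.red + 2)) v)) q) =
    (augMu c q).retag Y' X := by
  rw [sumSplit₃, sumSplit_eq_left, sumSplit_eq_right]
  · funext a
    have h1 : (augMu c q).retag Y' X a = sgn K c.red * eval c (D.diff (gen K a.1)) := rfl
    rw [h1, augMu_eq_beta]
    simp only [append, leadTerm, Pi.smul_apply, smul_eq_mul, AugHom.val_smul, beta_val, red]
    rw [← mul_assoc, show c.red + 2 - 1 = 0 + c.red + 1 by ring, sgn_mul_self, one_mul]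
  · intro V U k u a w
    exact smul_zero _
  · intro V U k a u t
    have : ∀ (V' : Augmentation D) (m : Chain (AugHom D) V V') (v : Chain (AugHom D) V' X),
        leadTerm Y' ((cons a u).append (cons (augMu m (m.red + 2)) v)) q = 0 := by
      intro V' m v
      cases u <;> rfl
    simp only [this, smul_zero, sumSplit_zero]

/-- This is the A∞-relation for the longer chain (h, c). Its terms match those of the module
relation coming from μ(h, …), except the one with μ¹(h). Since h∂ = Y - Y', that term telescopes to
a difference of μ(c) with respect to Y and Y', which the identity part cancels. -/
theorem homotopyMap_relation {Y' Y X : Augmentation D} {h : AugHom D Y' Y 0} (hh : IsHomotopy h)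
    (c : Chain (AugHom D) Y X) (q : ℤ) :
    (c.sumSplit fun _ u v =>
        sgn K (u.red + 1) • augMu (cons (homotopyMap h u (u.red + 1)) v) q) +
      (c.sumSplit₃ fun _ _ u m v =>
        sgn K (u.red + m.red + 1) •
          homotopyMap h (u.append (cons (augMu m (m.red + 2)) v)) q) = 0 := by
  -- The second sum: the identity part contributes μ(c), the rest are the terms of the relation for
  -- (h, c) with h outside the inner operation.
  have h2 : (c.sumSplit₃ fun _ _ u m v =>
        sgn K (u.red + m.red + 1) •
          homotopyMap h (u.append (cons (augMu m (m.red + 2)) v)) q) =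
      (augMu c q).retag Y' X - sgn K c.red • c.sumSplit₃ fun _ _ u m v =>
        sgn K v.red • augMu (cons h (u.append (cons (augMu m (m.red + 2)) v))) q := by
    rw [← sumSplit₃_leadTerm, sub_eq_add_neg, ← neg_smul]
    simp only [sumSplit₃, smul_sumSplit, ← sumSplit_add]
    refine sumSplit_congr _ _ _ fun V u t hut => ?_
    refine sumSplit_congr _ _ _ fun V' m v hmv => ?_
    rw [homotopyMap_append_cons, smul_add, smul_smul]
    congr 2
    rw [← hut, ← hmv, sgn_add, sgn_add, sgn_add, sgn_add]
    have : sgn K 1 = -1 := by simp [sgn]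
    linear_combination (sgn K u.red * sgn K m.red) * this +
      sgn K u.red * sgn K m.red * sgn_mul_self K v.red
  have rel := augMu_relation (cons h c) q
  rw [h2]
  cases c with
  | nil X =>
    -- For the empty chain every term contains T or μ of the empty chain, which is zero.
    have e1 : ∀ k, augMu (cons h (cons (0 : AugHom D Y Y k) (nil Y))) q = 0 := by
      intro k
      have := (augMu_multilinear Y' Y q).map_smul (k := k) (single h) 0 0 (nil Y)
      simpa only [single, append, zero_smul] using this
    simp only [sumSplit₃, sumSplit, homotopyMap, augMu_cons_zero, smul_zero, append, augMu_nil, e1]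
    simp [AugHom.retag]
  | @cons _ W _ j f v =>
    -- The first sum: the identity part contributes μ(f, v) read with Y' in place of Y, the rest are
    -- the terms whose inner operation contains both h and f.
    have h1 : ((cons f v).sumSplit fun _ u v =>
        sgn K (u.red + 1) • augMu (cons (homotopyMap h u (u.red + 1)) v) q) =
        -augMu (cons (f.retag Y' W) v) q - sgn K (cons f v).red • v.sumSplit fun _ m w =>
          sgn K w.red • augMu (cons (augMu (cons h (cons f m))
            ((cons h (cons f m)).red + 2)) w) q := by
      rw [← sumSplit_leadTerm, sumSplit, homotopyMap, augMu_cons_zero, smul_zero, zero_add,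
        sub_eq_add_neg, ← neg_smul, smul_sumSplit, ← sumSplit_add]
      refine sumSplit_congr _ _ _ fun V u w huw => ?_
      have e := (augMu_multilinear Y' X q).map_add (nil Y') (leadTerm Y' (cons f u) ((cons f u).red + 1))
        (augMu (cons h (cons f u)) ((cons f u).red + 1)) w
      simp only [append] at e
      rw [homotopyMap, e, smul_add, smul_smul,
        augMu_cons_augMu_congr (cons h (cons f u)) w
          (show (cons f u).red + 1 = (cons h (cons f u)).red + 2 by simp only [red]; ring)]
      congr 2
      have e2 : (cons f v).red = (cons f u).red + w.red := by simp only [red, ← huw]; ring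
      have : sgn K 1 = -1 := by simp [sgn]
      rw [e2, sgn_add, sgn_add]
      linear_combination sgn K (cons f u).red * this +
        sgn K (cons f u).red * sgn_mul_self K w.red
    -- Here μ¹(h) is minus the form Y - Y', because h has reduced degree -1, so the telescoping
    -- identity applies.
    have h3 : augMu (cons (augMu (single h) ((single h).red + 2)) (cons f v)) q =
        -((augMu (cons f v) q).retag Y' X - augMu (cons (f.retag Y' W) v) q) := by
      funext a
      have e : augMu (single h) ((single h).red + 2) =
          (-1 : K) • coboundary h ((single h).red + 2) := by
        rw [augMu_single]
        simp [sgn]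
      have e' := (augMu_multilinear Y' X q).map_smul (nil Y') (-1 : K)
        (coboundary h ((single h).red + 2)) (cons f v)
      simp only [append] at e'
      have hd : (single h).red + 2 = 0 + 1 := by simp only [single, red]; ring
      have e3 := eval_difference (coboundary h ((single h).red + 2)) (fun a => by
        rw [coboundary_val h hd, hh a]) f v (D.diff (gen K a.1))
      have e4 : (augMu (cons f v) q).retag Y' X a =
        sgn K (cons f v).red * eval (cons f v) (D.diff (gen K a.1)) := rfl
      rw [e, e']
      simp only [Pi.neg_apply, Pi.sub_apply, Pi.smul_apply, smul_eq_mul, e4, augMu, e3]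
      simp only [red, single]
      rw [show (0 - 1 + 0 + 2 - 1 + (j - 1 + v.red) : ℤ) = j - 1 + v.red by ring]
      ring
    simp only [sumSplit₃, sumSplit, append, augMu_nil, augMu_cons_zero, smul_zero, zero_add] at rel
    rw [h1]
    -- The remaining algebra: s is the sign of c, κ the term with μ¹(h), A the terms with h and f
    -- inside, B those with h outside.
    have key : ∀ {M : Type (max u w)} [AddCommGroup M] [Module K M] (s : K) (hs : s * s = 1)
      (E E' κ A B : M) (_ : κ = -(E - E')) (_ : s • κ + A + B = 0),
        -E' - s • A + (E - s • B) = 0 := by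
      intro M _ _ s hs E E' κ A B h1 h2
      have h5 : A + B = -(s • κ) := by rw [eq_neg_iff_add_eq_zero, ← h2]; abel
      have h6 : s • A + s • B = -κ := by rw [← smul_add, h5, smul_neg, smul_smul, hs, one_smul]
      rw [h1] at h6
      have : -E' - s • A + (E - s • B) = -E' + E - (s • A + s • B) := by abel
      rw [this, h6]
      abel
    refine key _ (sgn_mul_self K _) _ _ _ _ _ h3 ?_
    simp only [sumSplit₃, sumSplit, append, augMu_nil]
    exact rel

/-- The morphism of Yoneda modules given by a homotopy. -/
noncomputable def homotopyMorphism {Y' Y : Augmentation D} (h : AugHom D Y' Y 0)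
    (hh : IsHomotopy h) : YonedaMorphism (Aug D) Y Y' where
  map := homotopyMap h
  map_nil _ := rfl
  map_degree := homotopyMap_degree h
  map_multilinear := homotopyMap_multilinear h
  map_relation := homotopyMap_relation hh

end Homotopy

/-! ### The linear part of a homotopy and its pull-back -/

section LinearPart

variable {K : Type w} [Field K] {D : SemiFreeDGA.{u} K} {D' : SemiFreeDGA.{u'} K}

/-- The form `μ^2(h, f)`, up to sign. -/
noncomputable def homotopyProd {Y' Y X : Augmentation D} {k : ℤ} (h : AugHom D Y' Y 0)
    (f : AugHom D Y X k) : AugHom D Y' X k :=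
  fun a => eval (cons h (single f)) (D.diff (gen K a.1))

/-- The linear part of the morphism of Yoneda modules given by a homotopy, up to sign. -/
noncomputable def homotopyLinear {Y' Y X : Augmentation D} {k : ℤ} (h : AugHom D Y' Y 0)
    (f : AugHom D Y X k) : AugHom D Y' X k :=
  f.retag Y' X - homotopyProd h f

theorem homotopyMap_single {Y' Y X : Augmentation D} {k : ℤ} (h : AugHom D Y' Y 0)
    (f : AugHom D Y X k) : homotopyMap h (single f) k = sgn K (k - 1) • homotopyLinear h f := by
  funext a
  have h1 : leadTerm Y' (single f) k a = sgn K (k - 1) * f a := by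
    rw [← AugHom.val_coe f]
    rfl
  have h2 : homotopyMap h (single f) k = leadTerm Y' (single f) k + augMu (cons h (single f)) k :=
    rfl
  have h3 : f.retag Y' X a = f a := rfl
  rw [h2, Pi.add_apply, h1]
  simp only [homotopyLinear, homotopyProd, augMu, Pi.smul_apply, Pi.sub_apply, smul_eq_mul, h3]
  have h4 : sgn K (cons h (single f)).red = -sgn K (k - 1) := by
    have : (cons h (single f)).red = -1 + (k - 1) := by simp only [single, red]; ring
    rw [this, sgn_add]
    simp [sgn]
  rw [h4]
  ring

/-- `eval_diff` for the pair (h, f), with the term containing h∂ = Y - Y' telescoped. In particular,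
for a cocycle f only f - (h, f)∘∂ remains, so the linear part respects cocycles and coboundaries. -/
theorem eval_homotopyLinear {Y' Y X : Augmentation D} {k : ℤ} {h : AugHom D Y' Y 0}
    (hh : IsHomotopy h) (f : AugHom D Y X k) (x : WordAlg K D.Gen) :
    eval (single (homotopyLinear h f)) x = eval (single f) x -
      eval (cons h (single (coboundary f (k + 1)))) x - eval (cons h (single f)) (D.diff x) := by
  have key := eval_diff (cons h (single f)) x
  simp only [single, sumSplit₃, sumSplit, append, beta_nil] at key
  have h0 : sgn K (nil Y' : Chain (AugHom D) Y' Y').red = 1 := sgn_zero K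
  have h1 := eval_zero_middle (k := (nil Y' : Chain (AugHom D) Y' Y').red + 2) (nil Y')
    (cons h (cons f (nil X))) x
  have h2 := eval_zero_middle (k := (nil Y : Chain (AugHom D) Y Y).red + 2) (cons h (nil Y))
    (cons f (nil X)) x
  have h3 := eval_zero_middle (k := (nil X : Chain (AugHom D) X X).red + 2)
    (cons h (cons f (nil X))) (nil X) x
  simp only [append] at h1 h2 h3
  rw [h0, h1, h2, h3] at key
  have h4 := eval_difference (beta (single h)) (fun a => by rw [beta_val, hh a]) f (nil X) x
  have h5 : ∀ q, q = k + 1 → eval (cons h (single (coboundary f q))) x =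
      eval (cons h (single (coboundary f (k + 1)))) x := by
    rintro q rfl
    rfl
  have h6 : ∀ q, q = k → eval (single (Hom := AugHom D) (Y := Y') (X := X) (k := q)
      fun a => eval (cons h (single f)) (D.diff (gen K a.1))) x =
        eval (single (homotopyProd h f)) x := by
    rintro q rfl
    rfl
  have h5' : eval (cons h (cons (beta (cons f (nil X))) (nil X))) x = _ :=
    h5 ((single f).red + 2) (by simp only [single, red]; ring)
  have h6' : eval (cons (beta (cons h (cons f (nil X)))) (nil X)) x = _ :=
    h6 ((cons h (single f)).red + 2) (by simp only [single, red]; ring)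
  have h7 : sgn K (cons h (nil Y)).red = -1 := by simp [sgn, red]
  simp only [single] at h4
  rw [h4, h5', h6', h7] at key
  rw [homotopyLinear, eval_single_sub]
  simp only [single] at key ⊢
  linear_combination key

theorem IsCocycle.coboundary_eq_zero {Y X : Augmentation D} {k : ℤ} {f : AugHom D Y X k}
    (hf : IsCocycle f) (l : ℤ) : coboundary f l = 0 := funext fun _ => hf _

theorem eval_cons_single_zero {Z Y X : Augmentation D} {k l : ℤ} (h : AugHom D Z Y k)
    (x : WordAlg K D.Gen) : eval (cons h (single (0 : AugHom D Y X l))) x = 0 :=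
  eval_zero_middle (single h) (nil X) x

theorem eval_homotopyLinear_of_isCocycle {Y' Y X : Augmentation D} {k : ℤ} {h : AugHom D Y' Y 0}
    (hh : IsHomotopy h) {f : AugHom D Y X k} (hf : IsCocycle f) (x : WordAlg K D.Gen) :
    eval (single (homotopyLinear h f)) x =
      eval (single f) x - eval (cons h (single f)) (D.diff x) := by
  rw [eval_homotopyLinear hh, hf.coboundary_eq_zero, eval_cons_single_zero, sub_zero]

theorem IsCocycle.homotopyLinear {Y' Y X : Augmentation D} {k : ℤ} {h : AugHom D Y' Y 0}
    (hh : IsHomotopy h) {f : AugHom D Y X k} (hf : IsCocycle f) :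
    IsCocycle (homotopyLinear h f) := fun x => by
  rw [eval_homotopyLinear_of_isCocycle hh hf, hf, D.diff_diff, map_zero, sub_zero]

theorem IsCoboundary.homotopyLinear {Y' Y X : Augmentation D} {k : ℤ} {h : AugHom D Y' Y 0}
    (hh : IsHomotopy h) {f : AugHom D Y X k} (hf : IsCoboundary f) :
    IsCoboundary (homotopyLinear h f) := by
  have hc := hf.isCocycle
  obtain ⟨g, hg⟩ := hf
  refine ⟨AInf.homotopyLinear h g, fun x => ?_⟩
  have hk : k = k - 1 + 1 := by ring
  have h1 : f = coboundary g k :=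
    AugHom.ext_val fun a => by rw [coboundary_val g hk, ← hg, eval_single_gen]
  have h2 : ∀ l, l = k → eval (cons h (single (coboundary g l))) (D.diff x) =
      eval (cons h (single f)) (D.diff x) := by
    rintro l rfl
    rw [h1]
  rw [eval_homotopyLinear_of_isCocycle hh hc, eval_homotopyLinear hh, D.diff_diff, map_zero,
    h2 _ hk.symm, hg, sub_zero]

theorem homotopyLinear_add {Y' Y X : Augmentation D} {k : ℤ} (h : AugHom D Y' Y 0)
    (f g : AugHom D Y X k) :
    homotopyLinear h (f + g) = homotopyLinear h f + homotopyLinear h g := by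
  have h1 : homotopyProd h (f + g) = homotopyProd h f + homotopyProd h g :=
    funext fun a => eval_add_middle (single h) f g (nil X) _
  have h2 : (f + g).retag Y' X = f.retag Y' X + g.retag Y' X := rfl
  rw [homotopyLinear, homotopyLinear, homotopyLinear, h1, h2]
  abel

theorem homotopyLinear_smul {Y' Y X : Augmentation D} {k : ℤ} (h : AugHom D Y' Y 0)
    (r : K) (f : AugHom D Y X k) : homotopyLinear h (r • f) = r • homotopyLinear h f := by
  have h1 : homotopyProd h (r • f) = r • homotopyProd h f :=
    funext fun a => eval_smul_middle (single h) r f (nil X) _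
  have h2 : (r • f).retag Y' X = r • f.retag Y' X := rfl
  rw [homotopyLinear, homotopyLinear, h1, h2, smul_sub]

theorem homotopyLinear_sub {Y' Y X : Augmentation D} {k : ℤ} (h : AugHom D Y' Y 0)
    (f g : AugHom D Y X k) :
    homotopyLinear h (f - g) = homotopyLinear h f - homotopyLinear h g := by
  rw [sub_eq_add_neg, sub_eq_add_neg, ← neg_one_smul K g, homotopyLinear_add, homotopyLinear_smul,
    neg_one_smul]

/-- The chain rule for two entries: they form two blocks or one. The one-block term is F²(h, f),
later a primitive for the failure of the linear part to commute with pull-back. -/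
theorem eval_comp_pair (g : DGAHom D' D) {Z Y X : Augmentation D} {k l : ℤ} (h : AugHom D Z Y k)
    (f : AugHom D Y X l) (x : WordAlg K D'.Gen) :
    eval (cons h (single f)) (g.hom x) =
      eval (cons (h.pull g) (single (f.pull g))) x +
        eval (single (pullMap g (cons h (single f)) (k + l - 1))) x := by
  have h1 : ∀ p q, p = k → q = l →
      eval (cons (pullMap g (single h) p) (cons (pullMap g (single f) q) (nil _))) x =
      eval (cons (h.pull g) (single (f.pull g))) x := by
    rintro p q rfl rfl
    rfl
  have h2 : ∀ p, p = k + l - 1 → eval (cons (pullMap g (cons h (single f)) p) (nil _)) x =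
      eval (single (pullMap g (cons h (single f)) (k + l - 1))) x := by
    rintro p rfl
    rfl
  rw [eval_comp, ← h1 ((single h).red + 1) ((single f).red + 1) (by simp only [single, red]; ring)
    (by simp only [single, red]; ring), ← h2 ((cons h (single f)).red + 1)
    (by simp only [single, red]; ring), add_comm]
  rfl

theorem IsHomotopy.pull (g : DGAHom D' D) {Y' Y : Augmentation D} {h : AugHom D Y' Y 0}
    (hh : IsHomotopy h) : IsHomotopy (h.pull g) := fun a => by
  rw [eval_pull, g.comm, hh.eval_diff]
  rfl

/-- A homotopy induces a quasi-isomorphism of Yoneda modules if its linear part preserves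
cohomology. -/
theorem pseudoIsomorphic_of_isHomotopy {Y' Y : Augmentation D} {h : AugHom D Y' Y 0}
    (hh : IsHomotopy h)
    (hinj : ∀ (X : Augmentation D) (k : ℤ) (f : AugHom D Y X k), IsCocycle f →
      IsCoboundary (homotopyLinear h f) → IsCoboundary f)
    (hsurj : ∀ (X : Augmentation D) (k : ℤ) (f' : AugHom D Y' X k), IsCocycle f' →
      ∃ f : AugHom D Y X k, IsCocycle f ∧ IsCoboundary (f' - homotopyLinear h f)) :
    PseudoIsomorphic (Aug D) Y Y' := by
  refine ⟨homotopyMorphism h hh, fun (X : Augmentation D) => ?_⟩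
  have hs : ∀ (k : ℤ) (f : AugHom D Y' X k), IsCoboundary (sgn K (k - 1) • f) →
      IsCoboundary f := fun k f hf => by
    have := hf.smul (sgn K (k - 1))
    rwa [sgn_smul_sgn_smul] at this
  have := inducesIso_aug (D := D) (D' := D) (Y := Y) (X := X) (Y' := Y') (X' := X)
    (fun k =>
      { toFun := fun f => sgn K (k - 1) • homotopyLinear h f
        map_add' := fun f g => by rw [homotopyLinear_add, smul_add]
        map_smul' := fun r f => by rw [homotopyLinear_smul, smul_comm, RingHom.id_apply] })
    (fun _ _ hf => (hf.homotopyLinear hh).smul _) (fun _ _ hf => (hf.homotopyLinear hh).smul _)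
    (fun k f hf hf' => hinj X k f hf (hs _ _ hf'))
    (fun k f' hf' => by
      obtain ⟨f, hf, hb⟩ := hsurj X k f' hf'
      refine ⟨sgn K (k - 1) • f, hf.smul _, ?_⟩
      change IsCoboundary (f' - sgn K (k - 1) • homotopyLinear h (sgn K (k - 1) • f))
      rwa [homotopyLinear_smul, sgn_smul_sgn_smul])
  have e : (fun (k : ℤ) (a : AugHom D Y X k) => homotopyMap h (single a) k) =
      fun k a => sgn K (k - 1) • homotopyLinear h a :=
    funext fun k => funext fun a => homotopyMap_single h a
  have e' : (fun (k : ℤ) (a : (Aug D).Hom Y X k) => (homotopyMorphism h hh).map (single a) k) =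
      fun k a => sgn K (k - 1) • homotopyLinear h (show AugHom D Y X k from a) := e
  rw [e']
  exact this

/-- A homotopy `h` with `μ^2(h, f) = 0` for all `f` pulls back along a quasi-isomorphism to a
quasi-isomorphism of Yoneda modules. -/
theorem pseudoIsomorphic_pull (g : DGAHom D' D) (hg : IsQuasiIso g)
    (hobj : ∀ X : Augmentation D', ∃ X₀ : Augmentation D, X₀.pull g = X) {Y' Y : Augmentation D}
    {h : AugHom D Y' Y 0} (hh : IsHomotopy h)
    (h0 : ∀ (X : Augmentation D) (k : ℤ) (f : AugHom D Y X k), homotopyProd h f = 0) :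
    PseudoIsomorphic (Aug D') (Y.pull g) (Y'.pull g) := by
  -- As μ²(h, ·) vanishes, the identity on forms commutes with the differentials of C_{Y,X} and
  -- C_{Y',X}; so these have the same cocycles and coboundaries.
  have hdiff : ∀ {X : Augmentation D} {k : ℤ} (f : AugHom D Y X k) (a : D.Gen),
      eval (single (f.retag Y' X)) (D.diff (gen K a)) = eval (single f) (D.diff (gen K a)) := by
    intro X k f a
    have h1 := eval_homotopyLinear hh f (D.diff (gen K a))
    have h2 : eval (cons h (single (coboundary f (k + 1)))) (D.diff (gen K a)) = 0 := by
      by_cases ha : D.gr a + 1 = k + 1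
      · exact congrFun (h0 X (k + 1) (coboundary f (k + 1))) ⟨a, ha⟩
      · refine eval_degree _ (D.gr a - 1) _ (D.diff_homog _ _ (isHomog_gen D.gr a)) ?_
        simp only [single, red]
        omega
    rwa [homotopyLinear, h0, sub_zero, h2, D.diff_diff, map_zero, sub_zero, sub_zero] at h1
  have hcoc : ∀ {X : Augmentation D} {k : ℤ} (f : AugHom D Y X k),
      IsCocycle (f.retag Y' X) ↔ IsCocycle f := by
    intro X k f
    exact ⟨fun hf => isCocycle_of_gen fun a => by rw [← hdiff, hf],
      fun hf => isCocycle_of_gen fun a => by rw [hdiff, hf]⟩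
  have hcob : ∀ {X : Augmentation D} {k : ℤ} (f : AugHom D Y X k),
      IsCoboundary (f.retag Y' X) → IsCoboundary f := by
    rintro X k f ⟨p, hp⟩
    refine isCoboundary_of_gen (p.retag Y X) fun a => ?_
    have h1 := hdiff (p.retag Y X) a
    have h2 := hp (gen K a)
    rw [eval_single_gen] at h2
    exact h2.trans h1
  -- On cocycles, the linear part downstairs is the pulled-back identity up to the coboundary of
  -- F²(h, f).
  have hlin : ∀ {X : Augmentation D} {k : ℤ} (f : AugHom D Y X k), IsCocycle f →
      IsCoboundary (homotopyLinear (h.pull g) (f.pull g) - (f.retag Y' X).pull g) := by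
    intro X k f hf
    have e : (0 : ℤ) + k - 1 = k - 1 := by ring
    have h3 : ∀ x, eval (single (pullMap g (cons h (single f)) (0 + k - 1))) x =
        eval (single (pullMap g (cons h (single f)) (k - 1))) x := fun x => by rw [e]
    refine ⟨pullMap g (cons h (single f)) (k - 1), fun x => ?_⟩
    have h1 := eval_homotopyLinear_of_isCocycle hh hf (g.hom x)
    rw [homotopyLinear, h0, sub_zero] at h1
    have h2 := eval_comp_pair g h f (D'.diff x)
    rw [g.comm, h3] at h2
    rw [eval_single_sub, eval_homotopyLinear_of_isCocycle (hh.pull g) (hf.pull g), eval_pull,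
      eval_pull, h1]
    linear_combination h2
  refine pseudoIsomorphic_of_isHomotopy (hh.pull g) ?_ ?_
  · intro X k f' hf' hb
    -- The Yoneda modules are tested on all augmentations of D', while g controls cohomology only
    -- between pulled-back ones; `hobj` closes this gap.
    obtain ⟨X, rfl⟩ := hobj X
    obtain ⟨f, hf, hff⟩ := hg.surj f' hf'
    have h1 := hff.homotopyLinear (hh.pull g)
    rw [homotopyLinear_sub] at h1
    have h2 : IsCoboundary ((f.retag Y' X).pull g) := by
      have h3 := (hb.sub h1).sub (hlin f hf)
      have e : ∀ p q r : AugHom D' (Y'.pull g) (X.pull g) k, p - (p - q) - (q - r) = r :=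
        fun p q r => by abel
      rwa [e] at h3
    have h3 := hcob f (hg.inj _ ((hcoc f).2 hf) h2)
    have h4 := hff.add (h3.pull g)
    rwa [sub_add_cancel] at h4
  · intro X k f' hf'
    obtain ⟨X, rfl⟩ := hobj X
    obtain ⟨f, hf, hff⟩ := hg.surj f' hf'
    refine ⟨(f.retag Y X).pull g, ((hcoc (f.retag Y X)).1 hf).pull g, ?_⟩
    have h1 := hff.sub (hlin (f.retag Y X) ((hcoc (f.retag Y X)).1 hf))
    have e : ∀ p q r : AugHom D' (Y'.pull g) (X.pull g) k, p - q - (r - q) = p - r :=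
      fun p q r => by abel
    rwa [show (f.retag Y X).retag Y' X = f from rfl, e] at h1

end LinearPart

/-! ### Homogeneous parts -/

section Homogeneous

variable {K : Type w} [Field K] {S : Type u} (gr : S → ℤ)

theorem wordDeg_mul (l l' : FreeMonoid S) : wordDeg gr (l * l') = wordDeg gr l + wordDeg gr l' := by
  simp [wordDeg, FreeMonoid.toList_mul]

open Classical in
/-- The projection to the homogeneous part of degree `n`. -/
noncomputable def homogPart (n : ℤ) : WordAlg K S →ₗ[K] WordAlg K S :=
  (Finsupp.linearCombination K fun l : FreeMonoid S =>
    if wordDeg gr l = n then (MonoidAlgebra.single l 1 : WordAlg K S) else 0) ∘ₗ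
    (MonoidAlgebra.coeffLinearEquiv K).toLinearMap

open Classical in
theorem homogPart_word (n : ℤ) (l : List S) :
    homogPart (K := K) gr n (word K l) =
      if wordDeg gr (FreeMonoid.ofList l) = n then word K l else 0 := by
  simp [homogPart, word, MonoidAlgebra.coeffLinearEquiv]

open Classical in
theorem coeff_homogPart (n : ℤ) (x : WordAlg K S) (l : FreeMonoid S) :
    (homogPart gr n x).coeff l = if wordDeg gr l = n then x.coeff l else 0 := by
  induction x using MonoidAlgebra.induction_linear with
  | zero => simp
  | add x y hx hy =>
    rw [map_add, MonoidAlgebra.coeff_add, Finsupp.add_apply, hx, hy, MonoidAlgebra.coeff_add,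
      Finsupp.add_apply]
    split_ifs <;> simp
  | single m r =>
    have h1 : (MonoidAlgebra.single m r : WordAlg K S) = r • word K m.toList := by
      simp [word]
    rw [h1, map_smul, homogPart_word]
    by_cases hm : m = l
    · subst hm
      split_ifs <;> simp_all [word]
    · split_ifs <;> simp_all [word]

variable {gr}

theorem isHomog_iff (n : ℤ) (x : WordAlg K S) : IsHomog gr n x ↔ homogPart gr n x = x := by
  constructor
  · intro h
    refine MonoidAlgebra.ext (Finsupp.ext fun l => ?_)
    rw [coeff_homogPart]
    split_ifs with hl
    · rfl
    · by_contra h0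
      exact hl (h l (Ne.symm h0))
  · intro h l hl
    by_contra h0
    rw [← h, coeff_homogPart, if_neg h0] at hl
    exact hl rfl

theorem IsHomog.homogPart_of_ne {n m : ℤ} {x : WordAlg K S} (h : IsHomog gr m x) (hmn : m ≠ n) :
    homogPart gr n x = 0 := by
  refine MonoidAlgebra.ext (Finsupp.ext fun l => ?_)
  rw [coeff_homogPart]
  split_ifs with hl
  · by_contra h0
    exact hmn ((h l h0).symm.trans hl)
  · rfl

theorem isHomog_zero (n : ℤ) : IsHomog gr n (0 : WordAlg K S) := fun _ hl => absurd rfl hl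

theorem isHomog_word (l : List S) : IsHomog gr (wordDeg gr (FreeMonoid.ofList l)) (word K l) := by
  rw [isHomog_iff, homogPart_word, if_pos rfl]

theorem IsHomog.mul {n m : ℤ} {x y : WordAlg K S} (hx : IsHomog gr n x) (hy : IsHomog gr m y) :
    IsHomog gr (n + m) (x * y) := by
  classical
  intro l hl
  rw [MonoidAlgebra.coeff_mul] at hl
  obtain ⟨a, -, ha'⟩ := Finset.exists_ne_zero_of_sum_ne_zero hl
  obtain ⟨b, -, hb'⟩ := Finset.exists_ne_zero_of_sum_ne_zero ha'
  simp only at hb'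
  by_cases hab : a * b = l
  · rw [if_pos hab] at hb'
    rw [← hab, wordDeg_mul, hx a (left_ne_zero_of_mul hb'), hy b (right_ne_zero_of_mul hb')]
  · rw [if_neg hab] at hb'
    exact absurd rfl hb'

end Homogeneous

/-! ### Constructing DGA morphisms and recognising quasi-isomorphisms -/

section Morphisms

variable {K : Type w} [Field K] {D : SemiFreeDGA.{u} K} {D' : SemiFreeDGA.{u'} K}

theorem homogPart_algHom (F : WordAlg K D.Gen →ₐ[K] WordAlg K D'.Gen)
    (hF : ∀ l, IsHomog D'.gr (wordDeg D.gr (FreeMonoid.ofList l)) (F (word K l))) (n : ℤ)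
    (x : WordAlg K D.Gen) : F (homogPart D.gr n x) = homogPart D'.gr n (F x) := by
  refine linearMap_ext_word (f := F.toLinearMap ∘ₗ homogPart D.gr n)
    (g := homogPart D'.gr n ∘ₗ F.toLinearMap) (fun l => ?_) x
  simp only [LinearMap.comp_apply, AlgHom.toLinearMap_apply]
  rw [homogPart_word]
  split_ifs with h
  · exact ((isHomog_iff _ _).1 (h ▸ hF l)).symm
  · rw [map_zero, (hF l).homogPart_of_ne h]

/-- A morphism of DGAs is determined by its values on generators, where it suffices to check that it
is homogeneous and commutes with the differentials. -/
noncomputable def DGAHom.ofGen (F : WordAlg K D.Gen →ₐ[K] WordAlg K D'.Gen)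
    (hdeg : ∀ a, IsHomog D'.gr (D.gr a) (F (gen K a)))
    (hd : ∀ a, F (D.diff (gen K a)) = D'.diff (F (gen K a))) : DGAHom D D' where
  hom := F
  homog n x hx := by
    have hF : ∀ l, IsHomog D'.gr (wordDeg D.gr (FreeMonoid.ofList l)) (F (word K l)) := by
      intro l
      induction l with
      | nil =>
        have h1 : word K ([] : List D.Gen) = 1 := rfl
        rw [h1, map_one]
        exact isHomog_word ([] : List D'.Gen)
      | cons a l ih =>
        rw [word_cons, map_mul]
        exact (hdeg a).mul ih
    rw [isHomog_iff] at hx ⊢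
    rw [← homogPart_algHom F hF, hx]
  comm x := by
    refine linearMap_ext_word (f := F.toLinearMap ∘ₗ D.diff) (g := D'.diff ∘ₗ F.toLinearMap)
      (fun l => ?_) x
    simp only [LinearMap.comp_apply, AlgHom.toLinearMap_apply]
    induction l with
    | nil =>
      have h1 : word K ([] : List D.Gen) = 1 := rfl
      rw [h1, diff_one, map_one, map_zero, diff_one]
    | cons a l ih =>
      rw [word_cons, D.leibniz _ _ _ (isHomog_gen D.gr a), map_mul, D'.leibniz _ _ _ (hdeg a),
        map_add, map_mul, map_smul, map_mul, hd, ih]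

/-- The inverse also preserves degrees: f commutes with the projections to homogeneous parts, which
characterise homogeneity, and f is injective. -/
theorem IsomorphicDGA.exists_hom (h : IsomorphicDGA D D') :
    ∃ (f : DGAHom D D') (g : DGAHom D' D), (∀ x, g.hom (f.hom x) = x) ∧
      ∀ y, f.hom (g.hom y) = y := by
  obtain ⟨f, hf, hd⟩ := h
  refine ⟨⟨f, hf, hd⟩, ⟨f.symm, fun n y hy => ?_, fun y => ?_⟩, f.symm_apply_apply,
    f.apply_symm_apply⟩
  · rw [isHomog_iff] at hy ⊢
    apply f.injective
    have := homogPart_algHom (f : WordAlg K D.Gen →ₐ[K] WordAlg K D'.Gen)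
      (fun l => hf _ _ (isHomog_word l)) n (f.symm y)
    simp only [AlgEquiv.coe_toAlgHom, AlgEquiv.apply_symm_apply] at this ⊢
    rw [this, hy]
  · apply f.injective
    simp only [AlgEquiv.coe_toAlgHom, hd, AlgEquiv.apply_symm_apply]

theorem wordAlg_algHom_ext {S : Type u} {R : Type v} [Semiring R] [Algebra K R]
    {F G : WordAlg K S →ₐ[K] R} (h : ∀ a, F (gen K a) = G (gen K a)) : F = G := by
  apply MonoidAlgebra.algHom_ext'
  · exact FreeMonoid.hom_eq h
  · ext

/-- Two algebra maps that agree on generators agree. -/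
theorem algHom_apply_of_gen {S : Type u} {R : Type v} [Semiring R] [Algebra K R]
    {F G : WordAlg K S →ₐ[K] R} (h : ∀ a, F (gen K a) = G (gen K a)) (x : WordAlg K S) :
    F x = G x := by rw [wordAlg_algHom_ext h]

/-! ### Quasi-isomorphisms with a one-sided inverse -/

theorem isCocycle_retag {Y X Y' X' : Augmentation D} {k : ℤ} (hY : Y' = Y) (hX : X' = X)
    (f : AugHom D Y X k) : IsCocycle (f.retag Y' X') ↔ IsCocycle f := by
  subst hY hX
  rfl

theorem isCoboundary_retag {Y X Y' X' : Augmentation D} {k : ℤ} (hY : Y' = Y) (hX : X' = X)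
    (f : AugHom D Y X k) : IsCoboundary (f.retag Y' X') ↔ IsCoboundary f := by
  subst hY hX
  rfl

theorem eval_retag {Y X Y' X' : Augmentation D} {k : ℤ} (hY : Y' = Y) (hX : X' = X)
    (f : AugHom D Y X k) (x : WordAlg K D.Gen) :
    eval (single (f.retag Y' X')) x = eval (single f) x := by
  subst hY hX
  rfl

theorem Augmentation.pull_pull {g : DGAHom D' D} {h : DGAHom D D'}
    (hgh : ∀ x, g.hom (h.hom x) = x) (Y : Augmentation D) : (Y.pull g).pull h = Y :=
  Augmentation.ext fun x => by rw [pull_apply, pull_apply, hgh]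

/-- The double pull-back of an augmentation is only propositionally the original one, whereas the
spaces of forms coincide definitionally. Stating the result with `retag` avoids casts. -/
theorem AugHom.pull_pull {g : DGAHom D' D} {h : DGAHom D D'} (hgh : ∀ x, g.hom (h.hom x) = x)
    {Y X : Augmentation D} {k : ℤ} (f : AugHom D Y X k) :
    (f.pull g).pull h = f.retag ((Y.pull g).pull h) ((X.pull g).pull h) := by
  funext a
  have h1 : (f.pull g).pull h a = eval (single (f.pull g)) (h.hom (gen K a.1)) := rfl
  rw [h1, eval_pull, hgh, eval_single_gen, AugHom.val_coe]
  rfl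

theorem isCoboundary_of_pull {g : DGAHom D' D} {h : DGAHom D D'}
    (hgh : ∀ x, g.hom (h.hom x) = x) {Y X : Augmentation D} {k : ℤ} (f : AugHom D Y X k)
    (hf : IsCoboundary (f.pull g)) : IsCoboundary f := by
  have h1 := hf.pull h
  rwa [AugHom.pull_pull hgh, isCoboundary_retag (Augmentation.pull_pull hgh Y)
    (Augmentation.pull_pull hgh X)] at h1

/-- Pulling back along g and then h is the identity, so g is injective on cohomology. For
surjectivity, f' and g^*h^*f' have the same pull-back along h, hence are cohomologous by injectivity
for h. -/
theorem IsQuasiIso.of_leftInverse {g : DGAHom D' D} {h : DGAHom D D'}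
    (hgh : ∀ x, g.hom (h.hom x) = x) (hh : IsQuasiIso h) : IsQuasiIso g where
  inj f _ hb := isCoboundary_of_pull hgh f hb
  surj {Y X k} f' hf' := by
    have hY := Augmentation.pull_pull hgh Y
    have hX := Augmentation.pull_pull hgh X
    refine ⟨(f'.pull h).retag Y X, (isCocycle_retag hY.symm hX.symm _).2 (hf'.pull h), ?_⟩
    have hc : IsCocycle ((f'.pull h).retag Y X) :=
      (isCocycle_retag hY.symm hX.symm _).2 (hf'.pull h)
    refine hh.inj _ (hf'.sub (hc.pull g)) ?_
    rw [AugHom.pull_sub, AugHom.pull_pull hgh]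
    have e : ((f'.pull h).retag Y X).retag ((Y.pull g).pull h) ((X.pull g).pull h) = f'.pull h :=
      rfl
    rw [e, sub_self]
    exact isCoboundary_zero

theorem IsQuasiIso.of_inverse {g : DGAHom D' D} {h : DGAHom D D'}
    (hgh : ∀ x, g.hom (h.hom x) = x) (hhg : ∀ y, h.hom (g.hom y) = y) : IsQuasiIso g where
  inj f _ hb := isCoboundary_of_pull hgh f hb
  surj {Y X k} f' hf' := by
    have hY := Augmentation.pull_pull hgh Y
    have hX := Augmentation.pull_pull hgh X
    refine ⟨(f'.pull h).retag Y X, (isCocycle_retag hY.symm hX.symm _).2 (hf'.pull h), ?_⟩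
    have e : ((f'.pull h).retag Y X).pull g = f' := by
      funext a
      have h1 : ((f'.pull h).retag Y X).pull g a =
        eval (single ((f'.pull h).retag Y X)) (g.hom (gen K a.1)) := rfl
      rw [h1, eval_retag hY.symm hX.symm, eval_pull, hhg, eval_single_gen, AugHom.val_coe]
    rw [e, sub_self]
    exact isCoboundary_zero

end Morphisms

/-! ### Stabilisations by a family of cancelling pairs -/

/-- `D₁` arises from `D` by adding a family of pairs of generators `b_i = (i, true)` and
`c_i = (i, false)` with `∂b_i = c_i`. -/
structure FamilyStabilisation {K : Type w} [Field K] (D D₁ : SemiFreeDGA.{u} K) where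
  ι : Type
  e : D.Gen ⊕ (ι × Bool) ≃ D₁.Gen
  gr_gen : ∀ a : D.Gen, D₁.gr (e (Sum.inl a)) = D.gr a
  gr_pair : ∀ i, D₁.gr (e (Sum.inr (i, false))) = D₁.gr (e (Sum.inr (i, true))) - 1
  diff_gen : ∀ a : D.Gen, D₁.diff (gen K (e (Sum.inl a))) =
    MonoidAlgebra.mapDomainAlgHom K K (FreeMonoid.map fun s : D.Gen => e (Sum.inl s))
      (D.diff (gen K a))
  diff_pair : ∀ i, D₁.diff (gen K (e (Sum.inr (i, true)))) = gen K (e (Sum.inr (i, false)))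

theorem mapDomainAlgHom_gen {K : Type w} [Field K] {S : Type u} {T : Type v} (f : S → T) (a : S) :
    MonoidAlgebra.mapDomainAlgHom K K (FreeMonoid.map f) (gen K a) = gen K (f a) := by
  simp [gen]

/-- Collecting all stabilisations into one family allows a single homotopy to treat all new
generators at once, so no composition of pseudo-isomorphisms is needed. -/
theorem exists_familyStabilisation {K : Type w} [Field K] {D D₁ : SemiFreeDGA.{u} K}
    (h : Relation.ReflTransGen IsStabilisation D D₁) : Nonempty (FamilyStabilisation D D₁) := by
  induction h with
  | refl =>
    refine ⟨⟨Empty, Equiv.sumEmpty _ _, fun _ => rfl, fun i => i.elim, fun a => ?_,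
      fun i => i.elim⟩⟩
    have h1 : (FreeMonoid.map fun s : D.Gen =>
      (Equiv.sumEmpty D.Gen (Empty × Bool)) (Sum.inl s)) = MonoidHom.id _ :=
      FreeMonoid.hom_eq fun a => rfl
    rw [h1, MonoidAlgebra.mapDomainAlgHom_id]
    rfl
  | @tail D₁ D₂ _ hs ih =>
    obtain ⟨s⟩ := ih
    obtain ⟨e, h1, h2, h3, h4⟩ := hs
    let E : D.Gen ⊕ ((s.ι ⊕ Unit) × Bool) ≃ D₂.Gen :=
      ((Equiv.refl _).sumCongr (Equiv.sumProdDistrib s.ι Unit Bool)).trans <|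
        (Equiv.sumAssoc _ _ _).symm.trans <|
          (s.e.sumCongr (Equiv.punitProd Bool)).trans e
    refine ⟨⟨s.ι ⊕ Unit, E, fun a => ?_, fun i => ?_, fun a => ?_, fun i => ?_⟩⟩
    · exact (h1 _).trans (s.gr_gen a)
    · rcases i with i | i
      · exact (h1 _).trans ((s.gr_pair i).trans (congrArg (· - 1) (h1 _).symm))
      · exact h2
    · have e1 : (FreeMonoid.map fun t : D.Gen => E (Sum.inl t)) =
          (FreeMonoid.map fun t : D₁.Gen => e (Sum.inl t)).comp
            (FreeMonoid.map fun t : D.Gen => s.e (Sum.inl t)) :=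
        FreeMonoid.hom_eq fun a => rfl
      rw [e1, MonoidAlgebra.mapDomainAlgHom_comp, AlgHom.comp_apply, ← s.diff_gen]
      exact h3 _
    · rcases i with i | i
      · refine (h3 (s.e (Sum.inr (i, true)))).trans ?_
        rw [s.diff_pair]
        exact mapDomainAlgHom_gen _ _
      · exact h4

namespace FamilyStabilisation

variable {K : Type w} [Field K] {D D₁ : SemiFreeDGA.{u} K} (s : FamilyStabilisation D D₁)

theorem diff_pair_false (i : s.ι) : D₁.diff (gen K (s.e (Sum.inr (i, false)))) = 0 := by
  rw [← s.diff_pair, D₁.diff_diff]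

/-- The inclusion of a semi-free DGA into a stabilisation. -/
noncomputable def incl : DGAHom D D₁ :=
  DGAHom.ofGen (MonoidAlgebra.mapDomainAlgHom K K (FreeMonoid.map fun a : D.Gen => s.e (Sum.inl a)))
    (fun a => by
      rw [mapDomainAlgHom_gen, ← s.gr_gen]
      exact isHomog_gen _ _)
    (fun a => by rw [mapDomainAlgHom_gen, s.diff_gen])

theorem incl_gen (a : D.Gen) : s.incl.hom (gen K a) = gen K (s.e (Sum.inl a)) :=
  mapDomainAlgHom_gen _ _

theorem diff_gen_eq_incl (a : D.Gen) :
    D₁.diff (gen K (s.e (Sum.inl a))) = s.incl.hom (D.diff (gen K a)) := s.diff_gen a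

/-- The algebra map underlying the projection of a stabilisation. -/
noncomputable def projAlgHom : WordAlg K D₁.Gen →ₐ[K] WordAlg K D.Gen :=
  MonoidAlgebra.lift K _ _ (FreeMonoid.lift fun a => Sum.elim (gen K) (fun _ => 0) (s.e.symm a))

theorem projAlgHom_gen (x : D.Gen ⊕ (s.ι × Bool)) :
    s.projAlgHom (gen K (s.e x)) = Sum.elim (gen K) (fun _ => 0) x := by
  simp [projAlgHom, gen, MonoidAlgebra.lift_single]

theorem projAlgHom_incl (x : WordAlg K D.Gen) : s.projAlgHom (s.incl.hom x) = x :=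
  algHom_apply_of_gen (F := s.projAlgHom.comp s.incl.hom) (G := AlgHom.id K _)
    (fun a => by
      rw [AlgHom.comp_apply, incl_gen, projAlgHom_gen]
      rfl) x

/-- The projection of a stabilisation, which kills the new generators. -/
noncomputable def proj : DGAHom D₁ D :=
  DGAHom.ofGen s.projAlgHom
    (fun a => by
      obtain ⟨x, rfl⟩ := s.e.surjective a
      rw [projAlgHom_gen]
      rcases x with x | x
      · rw [s.gr_gen]
        exact isHomog_gen _ _
      · exact isHomog_zero _)
    (fun a => by
      obtain ⟨x, rfl⟩ := s.e.surjective a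
      rw [projAlgHom_gen]
      rcases x with x | ⟨i, _ | _⟩
      · rw [diff_gen_eq_incl, projAlgHom_incl]
        rfl
      · rw [diff_pair_false, map_zero]
        exact (map_zero _).symm
      · rw [diff_pair, projAlgHom_gen]
        exact (map_zero _).symm)

theorem proj_incl (x : WordAlg K D.Gen) : s.proj.hom (s.incl.hom x) = x := s.projAlgHom_incl x

theorem proj_gen (x : D.Gen ⊕ (s.ι × Bool)) :
    s.proj.hom (gen K (s.e x)) = Sum.elim (gen K) (fun _ => 0) x := s.projAlgHom_gen x

/-- The form on the stabilisation with given values on the old and the new generators. -/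
noncomputable def form (Y X : Augmentation D₁) (k : ℤ) (φ : D.Gen ⊕ (s.ι × Bool) → K) :
    AugHom D₁ Y X k := fun a => φ (s.e.symm a.1)

theorem form_val (Y X : Augmentation D₁) (k : ℤ) (φ : D.Gen ⊕ (s.ι × Bool) → K)
    (x : D.Gen ⊕ (s.ι × Bool)) (hx : D₁.gr (s.e x) + 1 ≠ k → φ x = 0) :
    AugHom.val (s.form Y X k φ) (s.e x) = φ x := by
  rw [AugHom.val]
  split_ifs with h
  · simp [form]
  · exact (hx h).symm

theorem pull_incl_val {Y X : Augmentation D₁} {k : ℤ} (f : AugHom D₁ Y X k) (a : D.Gen) :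
    AugHom.val (f.pull s.incl) a = AugHom.val f (s.e (Sum.inl a)) := by
  rw [AugHom.pull_val, incl_gen, eval_single_gen]

/-- Differentials of old generators involve only old generators, so the values of a form on the new
ones can be adjusted freely. -/
theorem isQuasiIso_incl : IsQuasiIso s.incl where
  inj {Y X k} f hf hb := by
    obtain ⟨p, hp⟩ := hb
    -- Extends the primitive p of the restriction of f: as ∂b_i = c_i, its value on c_i must be
    -- f(b_i). On c_i itself, f vanishes because c_i = ∂b_i and f is a cocycle.
    let φ : D.Gen ⊕ (s.ι × Bool) → K := fun x => match x with
      | Sum.inl a => AugHom.val p a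
      | Sum.inr (i, false) => AugHom.val f (s.e (Sum.inr (i, true)))
      | Sum.inr (_, true) => 0
    have hφ : ∀ x, AugHom.val (s.form Y X (k - 1) φ) (s.e x) = φ x := by
      intro x
      apply s.form_val
      intro hx
      rcases x with a | ⟨i, _ | _⟩
      · rw [s.gr_gen] at hx
        exact AugHom.val_of_ne p hx
      · have := s.gr_pair i
        exact AugHom.val_of_ne f (by omega)
      · rfl
    have hpull : (s.form Y X (k - 1) φ).pull s.incl = p :=
      AugHom.ext_val fun a => by rw [pull_incl_val, hφ]
    refine isCoboundary_of_gen (s.form Y X (k - 1) φ) fun a => ?_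
    obtain ⟨x, rfl⟩ := s.e.surjective a
    rcases x with a | ⟨i, _ | _⟩
    · rw [diff_gen_eq_incl, ← eval_pull, hpull, ← hp, eval_single_gen, pull_incl_val]
    · rw [diff_pair_false, map_zero, ← eval_single_gen, ← s.diff_pair, hf]
    · rw [s.diff_pair, eval_single_gen, hφ]
  surj {Y X k} f' hf' := by
    -- Extension by zero: it is a cocycle since ∂b_i = c_i and it vanishes on c_i.
    let φ : D.Gen ⊕ (s.ι × Bool) → K := Sum.elim (AugHom.val f') fun _ => 0
    have hφ : ∀ x, AugHom.val (s.form Y X k φ) (s.e x) = φ x := by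
      intro x
      apply s.form_val
      intro hx
      rcases x with a | i
      · rw [s.gr_gen] at hx
        exact AugHom.val_of_ne f' hx
      · rfl
    have hpull : (s.form Y X k φ).pull s.incl = f' :=
      AugHom.ext_val fun a => by rw [pull_incl_val, hφ]; rfl
    refine ⟨s.form Y X k φ, isCocycle_of_gen fun a => ?_, ?_⟩
    · obtain ⟨x, rfl⟩ := s.e.surjective a
      rcases x with a | ⟨i, _ | _⟩
      · rw [diff_gen_eq_incl, ← eval_pull, hpull, hf']
      · rw [diff_pair_false, map_zero]
      · rw [s.diff_pair, eval_single_gen, hφ]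
        rfl
    · rw [hpull, sub_self]
      exact isCoboundary_zero

theorem isQuasiIso_proj : IsQuasiIso s.proj :=
  IsQuasiIso.of_leftInverse s.proj_incl s.isQuasiIso_incl

/-- The homotopy between an augmentation of a stabilisation and the one that has the same restriction
and vanishes on the new generators. -/
noncomputable def homotopy (Y : Augmentation D₁) :
    AugHom D₁ ((Y.pull s.incl).pull s.proj) Y 0 :=
  s.form _ _ 0 fun x => match x with
    | Sum.inl _ => 0
    | Sum.inr (i, false) => Y.hom (gen K (s.e (Sum.inr (i, true))))
    | Sum.inr (_, true) => 0

theorem homotopy_val (Y : Augmentation D₁) (x : D.Gen ⊕ (s.ι × Bool)) :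
    AugHom.val (s.homotopy Y) (s.e x) = match x with
      | Sum.inl _ => 0
      | Sum.inr (i, false) => Y.hom (gen K (s.e (Sum.inr (i, true))))
      | Sum.inr (_, true) => 0 := by
  apply s.form_val
  intro hx
  rcases x with a | ⟨i, _ | _⟩
  · rfl
  · have := s.gr_pair i
    exact Y.hom_degree _ (by omega)
  · rfl

theorem homotopy_pull_incl (Y : Augmentation D₁) : (s.homotopy Y).pull s.incl = 0 :=
  AugHom.ext_val fun a => by
    rw [pull_incl_val, homotopy_val, ← eval_single_gen, eval_single_zero]

theorem isHomotopy_homotopy (Y : Augmentation D₁) : IsHomotopy (s.homotopy Y) := by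
  intro a
  obtain ⟨x, rfl⟩ := s.e.surjective a
  rw [Augmentation.pull_apply, Augmentation.pull_apply, proj_gen]
  rcases x with a | ⟨i, _ | _⟩
  · rw [diff_gen_eq_incl, ← eval_pull, homotopy_pull_incl, eval_single_zero, Sum.elim_inl, incl_gen,
      sub_self]
  · rw [diff_pair_false, map_zero, ← s.diff_pair, Y.hom_diff, Sum.elim_inr, map_zero, map_zero,
      sub_self]
  · rw [s.diff_pair, eval_single_gen, homotopy_val, Sum.elim_inr, map_zero, map_zero, sub_zero]

/-- The differential of a new generator is zero or a single letter, too short for two forms. In that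
of an old generator all letters are old, and h vanishes there. -/
theorem homotopyProd_homotopy (Y X : Augmentation D₁) (k : ℤ) (f : AugHom D₁ Y X k) :
    homotopyProd (s.homotopy Y) f = 0 := by
  funext a
  obtain ⟨a, ha⟩ := a
  obtain ⟨x, rfl⟩ := s.e.surjective a
  change eval (cons (s.homotopy Y) (single f)) (D₁.diff (gen K (s.e x))) = 0
  rcases x with a | ⟨i, _ | _⟩
  · have h1 : ∀ q, pullMap s.incl (cons (s.homotopy Y) (single f)) q = 0 := by
      intro q
      funext b
      change eval (cons (s.homotopy Y) (single f)) (s.incl.hom (gen K b.1)) = 0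
      rw [incl_gen]
      exact eval_cons_cons_gen _ _ _ _
    rw [diff_gen_eq_incl, eval_comp_pair, homotopy_pull_incl, h1, eval_single_zero, add_zero]
    exact eval_zero_middle (nil _) _ _
  · rw [diff_pair_false, map_zero]
  · rw [s.diff_pair]
    exact eval_cons_cons_gen _ _ _ _

end FamilyStabilisation

end AInf

/-! ### The invariance theorem -/

theorem theorem2 {K : Type w} [Field K] (D : AInf.SemiFreeDGA.{u} K)
    (D' : AInf.SemiFreeDGA.{v} K) (h : AInf.StableIsomorphic D D') :
    AInf.PseudoEquivalent (AInf.Aug D) (AInf.Aug D') := by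
  obtain ⟨D₁, D₁', hs, hs', hiso⟩ := h
  obtain ⟨s⟩ := AInf.exists_familyStabilisation hs
  obtain ⟨s'⟩ := AInf.exists_familyStabilisation hs'
  obtain ⟨f, f', hf, hf'⟩ := hiso.exists_hom
  have hq : AInf.IsQuasiIso (f'.comp s'.incl) :=
    (AInf.IsQuasiIso.of_inverse hf hf').comp s'.isQuasiIso_incl
  -- The map D₁ → D₁' → D' is a left inverse of D' → D₁' → D₁, so every augmentation of D' is a
  -- pull-back from D₁.
  have hobj : ∀ X : AInf.Augmentation D', (X.pull (s'.proj.comp f)).pull (f'.comp s'.incl) = X :=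
    AInf.Augmentation.pull_pull fun x => by
      change s'.proj.hom (f.hom (f'.hom (s'.incl.hom x))) = x
      rw [hf', s'.proj_incl]
  refine ⟨AInf.pullFunctor (s.proj.comp (f'.comp s'.incl)),
    (s.isQuasiIso_proj.comp hq).cohomFullyFaithful, fun (E : AInf.Augmentation D') => ?_⟩
  let Y : AInf.Augmentation D₁ := E.pull (s'.proj.comp f)
  -- The functor sends the restriction of Y to D to the pull-back of Y', the augmentation of D₁ that
  -- agrees with Y on old generators and kills the new ones.
  refine ⟨Y.pull s.incl, ?_⟩
  have key := AInf.pseudoIsomorphic_pull (f'.comp s'.incl) hq (fun X => ⟨_, hobj X⟩)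
    (s.isHomotopy_homotopy Y) (s.homotopyProd_homotopy Y)
  rw [hobj E] at key
  exact key
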